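/- Let $h>0$. A smooth immersed plane curve $X:\mathbb R\to\mathbb C=\mathbb R^2$, parametrized by arc length, generates the helicoidal surface of pitch $h$ parametrized by $F(s,t)=(e^{it}X(s),\,ht)\in\mathbb R^3$. Its mean curvature with respect to a unit normal $\mathbf n$ is $H=\operatorname{div}_\Sigma\mathbf n$ (so the cylinder of radius $1$ has $H=1$ for its outward normal). A closed immersed curve is such an $X$ that is periodic; it is considered over its least period $L>0$, i.e. traversed once. Its rotation number is $\frac1{2\pi}$ times the total change of the tangent angle over $[0,L]$. It has $q$-fold rotational symmetry if the rotations about the origin that carry it to itself (as a closed curve, up to a shift of the parameter) are exactly the $q$ rotations by multiples of $2\pi/q$. For a curve with positive rotation number, the outward unit normal of the surface is the one whose horizontal part points to the right of the curve, i.e. in the direction $-ie^{it}X'(s)$. Put $$\alpha_h=\frac{\sqrt{h^2+4}}{h\pi}\,E\!\left(\frac{2}{\sqrt{h^2+4}}\right)+\frac12,\qquad E(k)=\int_0^{\pi/2}\sqrt{1-k^2\sin^2\theta}\,d\theta .$$ **Theorem.** Let $p$ and $q$ be relatively prime positive integers such that $1<\frac pq<\frac{\sqrt{h^2+1}}{h}$.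 Then there exists a closed immersed curve $X$ with rotation number $p$ and $q$-fold rotational symmetry that generates a helicoidal surface of pitch $h$ with constant mean curvature $H=1$ with respect to the outward unit normal, and $X$ is unique up to rotation about the origin (and a shift of the arc length parameter). Moreover, - $X$ passes through the origin if and only if $\frac pq=\alpha_h$; - if $\frac pq>\alpha_h$, then $X$ has winding number $p$ around the origin; - if $\frac pq<\alpha_h$, then $X$ has winding number $p-q$ around the origin. -/

import Mathlib

open scoped ContDiff Matrix

noncomputable section

namespace CMCHelicoid

/-- The surface in three-space swept out by the planar curve `X` (in the plane `ℂ = ℝ²`) when it is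
rotated counterclockwise about the vertical axis with unit angular speed while being translated
along that axis with speed `h`: `F (s, t) = (e^{it} X(s), h t)`. -/
def helicoidalSurface (h : ℝ) (X : ℝ → ℂ) (s t : ℝ) : Fin 3 → ℝ :=
  ![(Complex.exp (t * Complex.I) * X s).re, (Complex.exp (t * Complex.I) * X s).im, h * t]

section Surface

/-! Geometry of a parametrized surface `F (s, t)` in three-space `Fin 3 → ℝ`; the Euclidean inner
product is the dot product. -/

/-- `∂F/∂s`. -/
def partialS (F : ℝ → ℝ → Fin 3 → ℝ) (s t : ℝ) : Fin 3 → ℝ := deriv (fun s' => F s' t) s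

/-- `∂F/∂t`. -/
def partialT (F : ℝ → ℝ → Fin 3 → ℝ) (s t : ℝ) : Fin 3 → ℝ := deriv (fun t' => F s t') t

/-- The unit normal field `(F_s × F_t) / |F_s × F_t|`. -/
def unitNormal (F : ℝ → ℝ → Fin 3 → ℝ) (s t : ℝ) : Fin 3 → ℝ :=
  let v := crossProduct (partialS F s t) (partialT F s t)
  (Real.sqrt (v ⬝ᵥ v))⁻¹ • v

/-- The mean curvature `H = div n = g^{ij} A_{ij}` with respect to the unit normal
`n = unitNormal F`, where `g_{ij} = ⟨F_i, F_j⟩` and `A_{ij} = -⟨F_{ij}, n⟩`, so that a round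
cylinder of radius `1` has `H = 1` for the normal pointing away from its axis. -/
def meanCurvature (F : ℝ → ℝ → Fin 3 → ℝ) (s t : ℝ) : ℝ :=
  let n := unitNormal F s t
  let g₁₁ := partialS F s t ⬝ᵥ partialS F s t
  let g₁₂ := partialS F s t ⬝ᵥ partialT F s t
  let g₂₂ := partialT F s t ⬝ᵥ partialT F s t
  let A₁₁ := -(partialS (partialS F) s t ⬝ᵥ n)
  let A₁₂ := -(partialS (partialT F) s t ⬝ᵥ n)
  let A₂₂ := -(partialT (partialT F) s t ⬝ᵥ n)
  (g₂₂ * A₁₁ - 2 * g₁₂ * A₁₂ + g₁₁ * A₂₂) / (g₁₁ * g₂₂ - g₁₂ ^ 2)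

end Surface

section Curve

/-- `X` is a closed immersed smooth plane curve, parametrized by arc length on the whole line and
traversed exactly once in each interval of length `L`: `L > 0` is the least period of `X`. -/
structure IsClosedImmersedCurve (X : ℝ → ℂ) (L : ℝ) : Prop where
  smooth : ContDiff ℝ ∞ X
  unit_speed : ∀ s, ‖deriv X s‖ = 1
  pos : 0 < L
  periodic : Function.Periodic X L
  least : ∀ c, 0 < c → Function.Periodic X c → L ≤ c

/-- The plane curve `γ` on `[0, L]` (extended periodically) avoids the origin and has winding
number `n` about it: a continuous choice of the polar angle increases by `2πn`. -/
def HasWindingNumber (γ : ℝ → ℂ) (L : ℝ) (n : ℤ) : Prop :=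
  (∀ s, γ s ≠ 0) ∧
    ∃ φ : ℝ → ℝ, Continuous φ ∧ (∀ s, γ s = (‖γ s‖ : ℂ) * Complex.exp (φ s * Complex.I)) ∧
      φ L - φ 0 = 2 * Real.pi * n

/-- The rotation number of `X` is `n`: the tangent angle increases by `2πn` along one period. -/
def HasRotationNumber (X : ℝ → ℂ) (L : ℝ) (n : ℤ) : Prop :=
  HasWindingNumber (deriv X) L n

/-- `X` has `q`-fold rotational symmetry: the rotations about the origin that carry the
curve to itself, up to a shift of the arc length parameter, are exactly the `q` rotations by the
multiples of `2π/q`. -/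
def HasFoldSymmetry (X : ℝ → ℂ) (q : ℕ) : Prop :=
  ∀ ζ : ℂ, (‖ζ‖ = 1 ∧ ∃ c : ℝ, ∀ s, ζ * X s = X (s + c)) ↔ ζ ^ q = 1

/-- `Y` is the image of `X` under a rotation about the origin, up to a shift of the arc length
parameter. -/
def EqUpToRotation (X Y : ℝ → ℂ) : Prop :=
  ∃ ζ : ℂ, ‖ζ‖ = 1 ∧ ∃ c : ℝ, ∀ s, Y s = ζ * X (s + c)

/-- `X` is a closed immersed curve with least period `L`, rotation number `p` and `q`-fold
rotational symmetry, generating a helicoidal surface of pitch `h` whose mean curvature is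
constantly `1` with respect to the outward unit normal. Here `F_s × F_t` is a positive multiple of
`(-h e^{it} i X'(s), ⟨X(s), X'(s)⟩)`, so its horizontal part points to the right of the
curve, which is the outward side for a curve with positive rotation number `p`. -/
structure IsGeneratingCurve (h : ℝ) (p q : ℕ) (X : ℝ → ℂ) (L : ℝ) : Prop where
  closed : IsClosedImmersedCurve X L
  rotation : HasRotationNumber X L p
  symmetric : HasFoldSymmetry X q
  meanCurvature_eq : ∀ s t, meanCurvature (helicoidalSurface h X) s t = 1

end Curve

/-- The complete elliptic integral of the second kind, as a function of the modulus `k`. -/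
def ellipticE (k : ℝ) : ℝ :=
  ∫ θ in (0 : ℝ)..(Real.pi / 2), Real.sqrt (1 - k ^ 2 * Real.sin θ ^ 2)

/-- The critical ratio `α_h`. -/
def criticalRatio (h : ℝ) : ℝ :=
  Real.sqrt (h ^ 2 + 4) / (h * Real.pi) * ellipticE (2 / Real.sqrt (h ^ 2 + 4)) + 1 / 2

end CMCHelicoid

end

/-! The position is written in the moving frame as X = zX' with z = τ + iν. By screw invariance the
mean curvature depends only on z and the curvature k of X, and H = 1 can be solved for k as `curv h
z`. Hence z obeys the autonomous planar equation z' = 1 − ikz, and X is recovered from z and the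
tangent angle θ, where θ' = k.

With w = √(τ² + h²), the quantity |z|² + 2hν/w is conserved (`energy_eq`). Since h² = w² − τ²,
completing the square turns it into τ²(1 + 1/w²) + (ν + h/w)² = R². Setting τ√(1 + 1/w²) = R sin φ
and ν + h/w = R cos φ makes every orbit a circle; R = 0 is the stationary point −i, which gives the
round cylinder. Along an orbit dθ equals √(1 + 1/w²) dφ minus the differential of τ/(hw)
(`hasDerivAt_angle`), so one turn of φ rotates the curve by A(R) = `totalAngle h R`, the integral of
√(1 + 1/w²) over a period.

A decreases strictly from 2π√(h² + 1)/h at R = 0 to the limit 2π, so exactly one R satisfies A(R) =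
2πp/q. Since p and q are coprime, the curve closes after exactly q turns and has q-fold symmetry.
Conversely, every point of the plane lies on some orbit, so uniqueness for the equation makes any
generating curve a rotated, shifted model curve (`exists_eq_rotation`), and the symmetry and
rotation number force the same R (`IsModel.of_rotation`).

An orbit meets the origin only for R = 1, where the integral can be evaluated by polar angles: A(1)
= 2πα_h (`totalAngle_one`). For R < 1 the orbit does not wind around 0, so X winds as often as its
tangent, p times; for R > 1 it winds once clockwise per turn, which subtracts q. As A decreases, R <
1 means p/q > α_h. -/

namespace CMCHelicoid

open Complex

/-! ### Mean curvature in the moving frame -/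

/-- The curvature of a generating curve as a function of the position `z = τ + iν` of the origin
relative to the moving frame. -/
noncomputable def curv (h : ℝ) (z : ℂ) : ℝ :=
  (√(z.re ^ 2 + h ^ 2) ^ 3 / h - z.im) / (z.re ^ 2 + z.im ^ 2 + h ^ 2)

theorem hasDerivAt_vec3 {f : ℝ → ℂ} {g : ℝ → ℝ} {f' : ℂ} {g' x : ℝ} (hf : HasDerivAt f f' x)
    (hg : HasDerivAt g g' x) :
    HasDerivAt (fun y => (![(f y).re, (f y).im, g y] : Fin 3 → ℝ)) ![f'.re, f'.im, g'] x := by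
  rw [hasDerivAt_pi]
  intro i
  fin_cases i
  · exact (Complex.reCLM.hasFDerivAt.comp_hasDerivAt x hf)
  · exact (Complex.imCLM.hasFDerivAt.comp_hasDerivAt x hf)
  · exact hg

theorem hasDerivAt_exp_mul_I (t : ℝ) :
    HasDerivAt (fun t : ℝ => exp (t * I)) (I * exp (t * I)) t := by
  have h1 : HasDerivAt (fun t : ℝ => (t : ℂ) * I) I t := by
    simpa using (Complex.ofRealCLM.hasDerivAt (x := t)).mul_const I
  simpa [mul_comm] using h1.cexp

theorem partialS_vec3 {a b : ℝ → ℝ → ℂ} {c : ℝ → ℝ → ℝ}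
    (h : ∀ s t, HasDerivAt (fun s => a s t) (b s t) s) (hc : ∀ s t, HasDerivAt (fun s => c s t) 0 s) :
    partialS (fun s t => ![(a s t).re, (a s t).im, c s t]) =
      fun (s t : ℝ) => ![(b s t).re, (b s t).im, 0] := by
  funext s t
  exact (hasDerivAt_vec3 (h s t) (hc s t)).deriv

theorem partialT_vec3 {a b : ℝ → ℝ → ℂ} {c d : ℝ → ℝ → ℝ}
    (h : ∀ s t, HasDerivAt (fun t => a s t) (b s t) t)
    (hc : ∀ s t, HasDerivAt (fun t => c s t) (d s t) t) :
    partialT (fun s t => ![(a s t).re, (a s t).im, c s t]) =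
      fun (s t : ℝ) => ![(b s t).re, (b s t).im, d s t] := by
  funext s t
  exact (hasDerivAt_vec3 (h s t) (hc s t)).deriv

/-- With e^{it}T = (a, b), all derivatives of F are expressed through a, b, τ, ν, k and h, and a² +
b² = 1 removes a and b from both fundamental forms. The cross product (hb, −ha, τ) has length √(τ² +
h²), whose square is also the determinant of the metric. -/
theorem meanCurvature_helicoidalSurface {h : ℝ} (hh : 0 < h) {X T T' : ℝ → ℂ}
    (hX : ∀ s, HasDerivAt X (T s) s) (hT : ∀ s, HasDerivAt T (T' s) s) (s t : ℝ) {z : ℂ} {k : ℝ}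
    (hn : ‖T s‖ = 1) (hz : X s = z * T s) (hk : T' s = k * I * T s) :
    meanCurvature (helicoidalSurface h X) s t =
      h * ((z.re ^ 2 + z.im ^ 2 + h ^ 2) * k + z.im) / √(z.re ^ 2 + h ^ 2) ^ 3 := by
  have e1 : helicoidalSurface h X =
      fun (s t : ℝ) => ![(exp (t * I) * X s).re, (exp (t * I) * X s).im, h * t] := rfl
  have eS : partialS (helicoidalSurface h X) =
      fun (s t : ℝ) => ![(exp (t * I) * T s).re, (exp (t * I) * T s).im, 0] := by
    rw [e1]
    exact partialS_vec3 (a := fun s (t : ℝ) => exp (t * I) * X s) (c := fun _ t : ℝ => h * t)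
      (fun s t => (hX s).const_mul _) (fun s t => hasDerivAt_const _ _)
  have eT : partialT (helicoidalSurface h X) =
      fun (s t : ℝ) => ![(I * exp (t * I) * X s).re, (I * exp (t * I) * X s).im, h] := by
    rw [e1]
    exact partialT_vec3 (a := fun s (t : ℝ) => exp (t * I) * X s) (c := fun _ t : ℝ => h * t)
      (d := fun _ _ => h)
      (fun s t => (hasDerivAt_exp_mul_I t).mul_const _)
      (fun s t => by simpa using (hasDerivAt_id t).const_mul h)
  have eSS : partialS (partialS (helicoidalSurface h X)) =
      fun (s t : ℝ) => ![(exp (t * I) * T' s).re, (exp (t * I) * T' s).im, 0] := by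
    rw [eS]
    exact partialS_vec3 (a := fun s (t : ℝ) => exp (t * I) * T s) (c := fun _ t => 0)
      (fun s t => (hT s).const_mul _) (fun s t => hasDerivAt_const _ _)
  have eST : partialS (partialT (helicoidalSurface h X)) =
      fun (s t : ℝ) => ![(I * exp (t * I) * T s).re, (I * exp (t * I) * T s).im, 0] := by
    rw [eT]
    exact partialS_vec3 (a := fun s (t : ℝ) => I * exp (t * I) * X s) (c := fun _ t => h)
      (fun s t => (hX s).const_mul _) (fun s t => hasDerivAt_const _ _)
  have eTT : partialT (partialT (helicoidalSurface h X)) =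
      fun (s t : ℝ) => ![(I * (I * exp (t * I)) * X s).re, (I * (I * exp (t * I)) * X s).im, 0] := by
    rw [eT]
    exact partialT_vec3 (a := fun s (t : ℝ) => I * exp (t * I) * X s) (c := fun _ t => h)
      (d := fun _ _ => 0)
      (fun s t => ((hasDerivAt_exp_mul_I t).const_mul I).mul_const _)
      (fun s t => hasDerivAt_const _ _)
  obtain ⟨x, y⟩ := z
  have hE : ‖exp (t * I) * T s‖ = 1 := by rw [norm_mul, hn, Complex.norm_exp_ofReal_mul_I, one_mul]
  generalize hEdef : exp (t * I) * T s = E at hE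
  have E1 : exp (t * I) * X s = ⟨x, y⟩ * E := by rw [← hEdef, hz]; ring
  have E2 : I * exp (t * I) * X s = I * (⟨x, y⟩ * E) := by rw [← E1]; ring
  have E3 : exp (t * I) * T' s = k * I * E := by rw [← hEdef, hk]; ring
  have E4 : I * exp (t * I) * T s = I * E := by rw [← hEdef]; ring
  have E5 : I * (I * exp (t * I)) * X s = - (⟨x, y⟩ * E) := by
    rw [← E1, ← mul_assoc, I_mul_I]; ring
  obtain ⟨a, b⟩ := E
  have hab : a ^ 2 + b ^ 2 = 1 := by
    have := Complex.sq_norm (⟨a, b⟩ : ℂ)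
    rw [hE, Complex.normSq_mk] at this
    linarith
  have hW : 0 < x ^ 2 + h ^ 2 := by positivity
  set W := √(x ^ 2 + h ^ 2) with hWdef
  have hWp : 0 < W := Real.sqrt_pos.2 hW
  have hW2 : W ^ 2 = x ^ 2 + h ^ 2 := Real.sq_sqrt hW.le
  have fS : partialS (helicoidalSurface h X) s t = ![a, b, 0] := by rw [eS]; simp only [hEdef]
  have fT : partialT (helicoidalSurface h X) s t = ![-(x * b + y * a), x * a - y * b, h] := by
    rw [eT]; simp only [E2]; simp
  have fSS : partialS (partialS (helicoidalSurface h X)) s t = ![-(k * b), k * a, 0] := by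
    rw [eSS]; simp only [E3]; simp
  have fST : partialS (partialT (helicoidalSurface h X)) s t = ![-b, a, 0] := by
    rw [eST]; simp only [E4]; simp
  have fTT : partialT (partialT (helicoidalSurface h X)) s t =
      ![-(x * a - y * b), -(x * b + y * a), 0] := by
    rw [eTT]; simp only [E5]; simp
  have fC : crossProduct ![a, b, 0] ![-(x * b + y * a), x * a - y * b, h] =
      ![h * b, -(h * a), x] := by
    simp only [cross_apply, Matrix.cons_val_zero, Matrix.cons_val_one, Matrix.cons_val]
    congr 1
    · ring
    congr 1
    · ring
    congr 1
    linear_combination x * hab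
  have fn : unitNormal (helicoidalSurface h X) s t = W⁻¹ • ![h * b, -(h * a), x] := by
    have : ![h * b, -(h * a), x] ⬝ᵥ ![h * b, -(h * a), x] = x ^ 2 + h ^ 2 := by
      simp only [Matrix.vec3_dotProduct, Matrix.cons_val_zero, Matrix.cons_val_one, Matrix.cons_val]
      linear_combination h ^ 2 * hab
    rw [unitNormal, fS, fT, fC, this]
  have g11 : ![a, b, 0] ⬝ᵥ ![a, b, 0] = (1 : ℝ) := by
    simp only [Matrix.vec3_dotProduct, Matrix.cons_val_zero, Matrix.cons_val_one, Matrix.cons_val]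
    linear_combination hab
  have g12 : ![a, b, 0] ⬝ᵥ ![-(x * b + y * a), x * a - y * b, h] = -y := by
    simp only [Matrix.vec3_dotProduct, Matrix.cons_val_zero, Matrix.cons_val_one, Matrix.cons_val]
    linear_combination -y * hab
  have g22 : ![-(x * b + y * a), x * a - y * b, h] ⬝ᵥ ![-(x * b + y * a), x * a - y * b, h] =
      x ^ 2 + y ^ 2 + h ^ 2 := by
    simp only [Matrix.vec3_dotProduct, Matrix.cons_val_zero, Matrix.cons_val_one, Matrix.cons_val]
    linear_combination (x ^ 2 + y ^ 2) * hab
  have a11 : ![-(k * b), k * a, 0] ⬝ᵥ ![h * b, -(h * a), x] = -(h * k) := by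
    simp only [Matrix.vec3_dotProduct, Matrix.cons_val_zero, Matrix.cons_val_one, Matrix.cons_val]
    linear_combination -h * k * hab
  have a12 : ![-b, a, 0] ⬝ᵥ ![h * b, -(h * a), x] = -h := by
    simp only [Matrix.vec3_dotProduct, Matrix.cons_val_zero, Matrix.cons_val_one, Matrix.cons_val]
    linear_combination -h * hab
  have a22 : ![-(x * a - y * b), -(x * b + y * a), 0] ⬝ᵥ ![h * b, -(h * a), x] = h * y := by
    simp only [Matrix.vec3_dotProduct, Matrix.cons_val_zero, Matrix.cons_val_one, Matrix.cons_val]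
    linear_combination h * y * hab
  rw [meanCurvature, fS, fT, fSS, fST, fTT, fn]
  simp only [dotProduct_smul, g11, g12, g22, a11, a12, a22, smul_eq_mul]
  have hd : 1 * (x ^ 2 + y ^ 2 + h ^ 2) - (-y) ^ 2 = W ^ 2 := by rw [hW2]; ring
  rw [hd]
  field_simp
  ring

theorem meanCurvature_eq_one_iff {h : ℝ} (hh : 0 < h) (z : ℂ) (k : ℝ) :
    h * ((z.re ^ 2 + z.im ^ 2 + h ^ 2) * k + z.im) / √(z.re ^ 2 + h ^ 2) ^ 3 = 1 ↔
      k = curv h z := by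
  have hW : 0 < √(z.re ^ 2 + h ^ 2) := Real.sqrt_pos.2 (by positivity)
  have hd : 0 < z.re ^ 2 + z.im ^ 2 + h ^ 2 := by positivity
  rw [curv, eq_div_iff hd.ne', div_eq_one_iff_eq (by positivity), eq_sub_iff_add_eq,
    eq_div_iff hh.ne']
  constructor <;> intro H <;> linear_combination H

/-- The second derivative of a unit speed curve. -/
theorem exists_curvature {X : ℝ → ℂ} (hX : ContDiff ℝ ∞ X) (hn : ∀ s, ‖deriv X s‖ = 1) (s : ℝ) :
    ∃ k : ℝ, deriv (deriv X) s = k * I * deriv X s := by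
  have hd : HasDerivAt (deriv X) (deriv (deriv X) s) s :=
    ((contDiff_infty_iff_deriv.1 hX).2.differentiable (by simp) s).hasDerivAt
  generalize deriv (deriv X) s = T' at hd
  have hre : HasDerivAt (fun s => (deriv X s).re) T'.re s :=
    Complex.reCLM.hasFDerivAt.comp_hasDerivAt s hd
  have him : HasDerivAt (fun s => (deriv X s).im) T'.im s :=
    Complex.imCLM.hasFDerivAt.comp_hasDerivAt s hd
  have hone : ∀ s, (deriv X s).re ^ 2 + (deriv X s).im ^ 2 = 1 := fun s => by
    have := Complex.sq_norm (deriv X s)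
    rw [hn, Complex.normSq_apply] at this
    linarith
  -- Differentiating |X'|² = 1 shows X'' ⟂ X', so X'' is a real multiple of iX'; the multiple is the
  -- determinant of X' and X''.
  have h1 := (hre.pow 2).add (him.pow 2)
  have h2 : HasDerivAt ((fun s => (deriv X s).re) ^ 2 + (fun s => (deriv X s).im) ^ 2) 0 s := by
    have : (fun s => (deriv X s).re) ^ 2 + (fun s => (deriv X s).im) ^ 2 = fun _ => (1 : ℝ) :=
      funext hone
    rw [this]
    exact hasDerivAt_const _ _
  have h3 := h1.unique h2
  simp only [Nat.cast_ofNat, Nat.add_one_sub_one, pow_one] at h3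
  have h4 := hone s
  generalize deriv X s = T at *
  refine ⟨T'.im * T.re - T'.re * T.im, Complex.ext ?_ ?_⟩
  · simp
    linear_combination -T'.re * h4 + T.re / 2 * h3
  · simp
    linear_combination -T'.im * h4 + T.im / 2 * h3

/-! ### Coordinates in which the orbits are circles -/

/-- The quantity `√(τ² + h²)` as a function of `x = τ √(1 + 1 / (τ² + h²))`. -/
noncomputable def radius (h x : ℝ) : ℝ :=
  √((h ^ 2 - 1 + x ^ 2 + √((h ^ 2 - 1 + x ^ 2) ^ 2 + 4 * h ^ 2)) / 2)

/-- The speed of the tangent angle, up to a periodic term. -/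
noncomputable def angleSpeed (h x : ℝ) : ℝ := √(1 + 1 / radius h x ^ 2)

noncomputable def tau (h x : ℝ) : ℝ := x / angleSpeed h x

theorem radius_arg_pos {h : ℝ} (hh : 0 < h) (x : ℝ) : 0 < h ^ 2 - 1 + x ^ 2 + √((h ^ 2 - 1 + x ^ 2) ^ 2 + 4 * h ^ 2) := by
  have : |h ^ 2 - 1 + x ^ 2| < √((h ^ 2 - 1 + x ^ 2) ^ 2 + 4 * h ^ 2) := by
    rw [← Real.sqrt_sq_eq_abs]
    exact Real.sqrt_lt_sqrt (by positivity) (by nlinarith [hh])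
  linarith [neg_abs_le (h ^ 2 - 1 + x ^ 2)]

theorem radius_pos {h : ℝ} (hh : 0 < h) (x : ℝ) : 0 < radius h x := Real.sqrt_pos.2 (half_pos (radius_arg_pos hh x))

/-- This is x² = (w² − h²)(1 + 1/w²) with denominators cleared: a quadratic in w² with root product
−h², so its only positive root is the one in the definition. All later facts about `radius` rest on
this relation. -/
theorem radius_quartic {h : ℝ} (hh : 0 < h) (x : ℝ) :
    radius h x ^ 4 + (1 - h ^ 2 - x ^ 2) * radius h x ^ 2 - h ^ 2 = 0 := by
  have h1 : radius h x ^ 2 = _ := Real.sq_sqrt (half_pos (radius_arg_pos hh x)).le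
  have h2 := Real.sq_sqrt (show 0 ≤ (h ^ 2 - 1 + x ^ 2) ^ 2 + 4 * h ^ 2 by positivity)
  rw [show radius h x ^ 4 = (radius h x ^ 2) ^ 2 by ring, h1]
  linear_combination h2 / 4

theorem contDiff_radius {h : ℝ} (hh : 0 < h) : ContDiff ℝ ∞ (radius h) := by
  unfold radius
  refine ContDiff.sqrt ?_ fun y => (half_pos (radius_arg_pos hh y)).ne'
  refine ContDiff.div_const (ContDiff.add (by fun_prop) (ContDiff.sqrt (by fun_prop) ?_)) _
  intro y
  positivity

/-- Implicit differentiation of the quartic; a factor w > 0 cancels. -/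
theorem hasDerivAt_radius {h : ℝ} (hh : 0 < h) (x : ℝ) :
    HasDerivAt (radius h) (x * radius h x ^ 3 / (radius h x ^ 4 + h ^ 2)) x := by
  have hd : HasDerivAt (radius h) (deriv (radius h) x) x :=
    ((contDiff_radius hh).differentiable (by simp) x).hasDerivAt
  have hp := radius_pos hh x
  have hq := radius_quartic hh x
  have h1 := ((hd.pow 4).add ((((hasDerivAt_id x).pow 2).const_sub (1 - h ^ 2)).mul
    (hd.pow 2))).sub_const (h ^ 2)
  have h2 := h1.unique ((hasDerivAt_const x (0 : ℝ)).congr_of_eventuallyEq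
    (Filter.Eventually.of_forall fun y => radius_quartic hh y))
  convert hd using 1
  simp at h2
  generalize radius h x = w at *
  generalize deriv (radius h) x = d at *
  rw [div_eq_iff (by positivity)]
  have : w * (x * w ^ 3 - d * (w ^ 4 + h ^ 2)) = 0 := by
    linear_combination w ^ 2 / (-2) * h2 + d * w * hq
  rcases mul_eq_zero.1 this with h | h <;> linarith

theorem angleSpeed_pos (h x : ℝ) : 0 < angleSpeed h x := Real.sqrt_pos.2 (by positivity)

theorem angleSpeed_sq {h : ℝ} (hh : 0 < h) (x : ℝ) : angleSpeed h x ^ 2 * radius h x ^ 2 = radius h x ^ 2 + 1 := by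
  have := radius_pos hh x
  rw [angleSpeed, Real.sq_sqrt (by positivity)]
  field_simp

theorem contDiff_angleSpeed {h : ℝ} (hh : 0 < h) : ContDiff ℝ ∞ (angleSpeed h) := by
  unfold angleSpeed
  refine ContDiff.sqrt (contDiff_const.add (contDiff_const.div ((contDiff_radius hh).pow 2) ?_)) ?_
  · intro y
    have := radius_pos hh y
    positivity
  · intro y
    positivity

theorem tau_mul_angleSpeed (h : ℝ) (x : ℝ) : tau h x * angleSpeed h x = x :=
  div_mul_cancel₀ _ (angleSpeed_pos h x).ne'

/-- Justifies reading `radius` as √(τ² + h²): the quartic is this identity multiplied by w² + 1,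
once x is replaced by τ times the angle speed. -/
theorem tau_sq {h : ℝ} (hh : 0 < h) (x : ℝ) : tau h x ^ 2 + h ^ 2 = radius h x ^ 2 := by
  have h1 := tau_mul_angleSpeed h x
  have h2 := angleSpeed_sq hh x
  have h3 := radius_quartic hh x
  have h4 := radius_pos hh x
  generalize radius h x = w at *
  generalize angleSpeed h x = m at *
  generalize tau h x = t at *
  have : (w ^ 2 + 1) * (t ^ 2 + h ^ 2 - w ^ 2) = 0 := by
    rw [← h1] at h3
    linear_combination -t ^ 2 * h2 - h3
  rcases mul_eq_zero.1 this with h | h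
  · nlinarith
  · linarith

theorem contDiff_tau {h : ℝ} (hh : 0 < h) : ContDiff ℝ ∞ (tau h) := by
  unfold tau
  exact contDiff_id.div (contDiff_angleSpeed hh) fun y => (angleSpeed_pos h y).ne'

/-- Obtained by differentiating the relations `angleSpeed_sq` and `tau_mul_angleSpeed`. -/
theorem hasDerivAt_tau {h : ℝ} (hh : 0 < h) (x : ℝ) : HasDerivAt (tau h)
    (angleSpeed h x * radius h x ^ 4 / (radius h x ^ 4 + h ^ 2)) x := by
  have hd : HasDerivAt (angleSpeed h) (deriv (angleSpeed h) x) x :=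
    ((contDiff_angleSpeed hh).differentiable (by simp) x).hasDerivAt
  have ht : HasDerivAt (tau h) (deriv (tau h) x) x :=
    ((contDiff_tau hh).differentiable (by simp) x).hasDerivAt
  have hr := hasDerivAt_radius hh x
  have h1 := ((hd.pow 2).mul (hr.pow 2)).sub ((hr.pow 2).add_const 1)
  have h2 := h1.unique ((hasDerivAt_const x (0 : ℝ)).congr_of_eventuallyEq
    (Filter.Eventually.of_forall fun y => sub_eq_zero.2 (angleSpeed_sq hh y)))
  have h3 := (ht.mul hd).unique ((hasDerivAt_id x).congr_of_eventuallyEq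
    (Filter.Eventually.of_forall fun y => tau_mul_angleSpeed h y))
  convert ht using 1
  simp at h2
  have e1 := tau_mul_angleSpeed h x
  have e2 := angleSpeed_sq hh x
  have e3 := radius_quartic hh x
  have e4 := radius_pos hh x
  have e5 := angleSpeed_pos h x
  have e6 := tau_sq hh x
  generalize deriv (angleSpeed h) x = dm at *
  generalize deriv (tau h) x = dt at *
  generalize radius h x = w at *
  generalize angleSpeed h x = m at *
  generalize tau h x = t at *
  clear h1 hd ht hr
  have hw : 0 < w ^ 4 + h ^ 2 := by positivity
  have hdm : dm * m * (w ^ 4 + h ^ 2) = -x := by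
    have : w ^ 2 * (dm * m * (w ^ 4 + h ^ 2) + x) = 0 := by
      field_simp at h2
      linear_combination h2 / 2 - x * w ^ 2 * e2
    rcases mul_eq_zero.1 this with h | h
    · exact absurd h (by positivity)
    · linarith
  rw [div_eq_iff hw.ne']
  have ht : t * dm * (w ^ 4 + h ^ 2) + t ^ 2 = 0 := by
    have : m * (t * dm * (w ^ 4 + h ^ 2) + t ^ 2) = 0 := by linear_combination t * hdm + t * e1
    exact (mul_eq_zero.1 this).resolve_left e5.ne'
  have : m * (m * w ^ 4 - dt * (w ^ 4 + h ^ 2)) = 0 := by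
    linear_combination (-(w ^ 4 + h ^ 2)) * h3 + w ^ 2 * e2 + ht - e6
  linarith [(mul_eq_zero.1 this).resolve_left e5.ne']

theorem tau_zero (h : ℝ) : tau h 0 = 0 := by simp [tau]

theorem radius_zero {h : ℝ} (hh : 0 < h) : radius h 0 = h := by
  have := tau_sq hh 0
  rw [tau_zero h] at this
  have h1 := radius_pos hh 0
  nlinarith

theorem tau_pos (h : ℝ) {x : ℝ} (hx : 0 < x) : 0 < tau h x := div_pos hx (angleSpeed_pos h x)

/-- Subtracting the quartics for x and y, each weighted by the other's squared radius, gives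
differences of w² and of x² the same sign. -/
theorem radius_lt_radius {h : ℝ} (hh : 0 < h) {x y : ℝ} (hxy : |x| < |y|) : radius h x < radius h y := by
  have hsq : x ^ 2 < y ^ 2 := sq_lt_sq.2 hxy
  have hx := radius_quartic hh x
  have hy := radius_quartic hh y
  have px := radius_pos hh x
  have py := radius_pos hh y
  by_contra! hle
  have h2 : radius h y ^ 2 ≤ radius h x ^ 2 := by gcongr
  have key : (radius h x ^ 2 - radius h y ^ 2) * (radius h x ^ 2 * radius h y ^ 2 + h ^ 2) =
      (x ^ 2 - y ^ 2) * (radius h x ^ 2 * radius h y ^ 2) := by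
    linear_combination radius h y ^ 2 * hx - radius h x ^ 2 * hy
  have h3 : 0 < radius h x ^ 2 * radius h y ^ 2 := by positivity
  have h4 : 0 ≤ (radius h x ^ 2 - radius h y ^ 2) * (radius h x ^ 2 * radius h y ^ 2 + h ^ 2) :=
    mul_nonneg (by linarith) (by positivity)
  nlinarith

/-! ### Orbits, arc length and tangent angle in terms of the phase -/

/-- The closed orbit of the position of the origin in the moving frame, for amplitude `R`. -/
noncomputable def orbit (h R φ : ℝ) : ℂ :=
  ⟨tau h (R * Real.sin φ), R * Real.cos φ - h / radius h (R * Real.sin φ)⟩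

/-- The derivative of arc length with respect to the phase. -/
noncomputable def arcSpeed (h R φ : ℝ) : ℝ :=
  h * (radius h (R * Real.sin φ) ^ 2 + (orbit h R φ).im ^ 2) * angleSpeed h (R * Real.sin φ) *
    radius h (R * Real.sin φ) / (radius h (R * Real.sin φ) ^ 4 + h ^ 2)

/-- The tangent angle as a function of the phase. -/
noncomputable def angle (h R φ : ℝ) : ℝ :=
  (∫ x in (0 : ℝ)..φ, angleSpeed h (R * Real.sin x)) -
    tau h (R * Real.sin φ) / (h * radius h (R * Real.sin φ))

/-- The increase of the tangent angle along one period of the phase. -/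
noncomputable def totalAngle (h R : ℝ) : ℝ :=
  ∫ x in (0 : ℝ)..(2 * Real.pi), angleSpeed h (R * Real.sin x)

theorem curv_orbit {h : ℝ} (hh : 0 < h) (R φ : ℝ) :
    curv h (orbit h R φ) * (radius h (R * Real.sin φ) ^ 2 + (orbit h R φ).im ^ 2) =
      radius h (R * Real.sin φ) ^ 3 / h - (orbit h R φ).im := by
  have h1 := tau_sq hh (R * Real.sin φ)
  have h2 := radius_pos hh (R * Real.sin φ)
  have h3 : (orbit h R φ).re ^ 2 + h ^ 2 = radius h (R * Real.sin φ) ^ 2 := h1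
  rw [curv, h3, Real.sqrt_sq h2.le,
    show (orbit h R φ).re ^ 2 + (orbit h R φ).im ^ 2 + h ^ 2 =
      radius h (R * Real.sin φ) ^ 2 + (orbit h R φ).im ^ 2 by linarith]
  exact div_mul_cancel₀ _ (by positivity)

theorem arcSpeed_pos {h : ℝ} (hh : 0 < h) (R φ : ℝ) : 0 < arcSpeed h R φ := by
  have h2 := radius_pos hh (R * Real.sin φ)
  have h3 := angleSpeed_pos h (R * Real.sin φ)
  unfold arcSpeed
  positivity

theorem hasDerivAt_phase (R φ : ℝ) :
    HasDerivAt (fun φ => R * Real.sin φ) (R * Real.cos φ) φ :=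
  (Real.hasDerivAt_sin φ).const_mul R

theorem hasDerivAt_mk {f g : ℝ → ℝ} {f' g' x : ℝ} (hf : HasDerivAt f f' x)
    (hg : HasDerivAt g g' x) : HasDerivAt (fun x => (⟨f x, g x⟩ : ℂ)) ⟨f', g'⟩ x := by
  simp only [Complex.mk_eq_add_mul_I]
  exact hf.ofReal_comp.add (hg.ofReal_comp.mul_const I)

/-- Up to the change of time `arcSpeed`, the circle parametrization solves z' = 1 − ikz; this is
what determines `arcSpeed`. -/
theorem hasDerivAt_orbit {h : ℝ} (hh : 0 < h) (R φ : ℝ) :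
    HasDerivAt (orbit h R)
      (arcSpeed h R φ * (1 - I * curv h (orbit h R φ) * orbit h R φ)) φ := by
  have ht := (hasDerivAt_tau hh _).comp φ (hasDerivAt_phase R φ)
  have hr := (hasDerivAt_radius hh _).comp φ (hasDerivAt_phase R φ)
  have hw := radius_pos hh (R * Real.sin φ)
  have hn := ((Real.hasDerivAt_cos φ).const_mul R).sub ((hasDerivAt_const φ h).div hr hw.ne')
  have hc := curv_orbit hh R φ
  refine HasDerivAt.congr_deriv (hasDerivAt_mk ht hn) ?_
  have e1 : (orbit h R φ).re = tau h (R * Real.sin φ) := rfl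
  have e2 : (orbit h R φ).im = R * Real.cos φ - h / radius h (R * Real.sin φ) := rfl
  have hm := angleSpeed_pos h (R * Real.sin φ)
  have h3 := tau_mul_angleSpeed h (R * Real.sin φ)
  have h4 := angleSpeed_sq hh (R * Real.sin φ)
  have h5 := tau_sq hh (R * Real.sin φ)
  rw [← e1] at h3 h5
  have hp : 0 < radius h (R * Real.sin φ) ^ 2 + (orbit h R φ).im ^ 2 := by positivity
  simp only [Function.comp_apply]
  unfold arcSpeed
  generalize orbit h R φ = z at *
  generalize curv h z = k at *
  generalize radius h (R * Real.sin φ) = w at *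
  generalize angleSpeed h (R * Real.sin φ) = m at *
  generalize R * Real.cos φ = u at *
  rw [show R * -Real.sin φ = -(z.re * m) by rw [h3]; ring, ← h3]
  clear hn ht hr h3 e1
  obtain ⟨t, v⟩ := z
  simp only at *
  have hd : 0 < w ^ 4 + h ^ 2 := by positivity
  have hu : u = v + h / w := by linarith
  have hc' : k * h * (w ^ 2 + v ^ 2) = w ^ 3 - h * v := by
    field_simp at hc; linarith
  apply Complex.ext
  · simp [-ofReal_div, -ofReal_mul, -ofReal_pow, -ofReal_add]
    rw [hu]
    field_simp
    linear_combination -v * hc'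
  · simp [-ofReal_div, -ofReal_mul, -ofReal_pow, -ofReal_add]
    rw [hu]
    field_simp
    linear_combination t * w * hc'

/-- Curvature times arc speed splits into `angleSpeed` and an exact term, the derivative of −τ/(hw).
The latter is periodic in the phase, so only the integral contributes to the turning over a period.
-/
theorem hasDerivAt_angle {h : ℝ} (hh : 0 < h) (R φ : ℝ) :
    HasDerivAt (angle h R) (arcSpeed h R φ * curv h (orbit h R φ)) φ := by
  have ht := (hasDerivAt_tau hh _).comp φ (hasDerivAt_phase R φ)
  have hr := (hasDerivAt_radius hh _).comp φ (hasDerivAt_phase R φ)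
  have hw := radius_pos hh (R * Real.sin φ)
  have hcont : Continuous fun x => angleSpeed h (R * Real.sin x) :=
    (contDiff_angleSpeed hh).continuous.comp (by fun_prop)
  have hi := hcont.integral_hasStrictDerivAt 0 φ
  refine HasDerivAt.congr_deriv
    (hi.hasDerivAt.sub (ht.div (hr.const_mul h) (mul_ne_zero hh.ne' hw.ne'))) ?_
  have hc := curv_orbit hh R φ
  have e2 : (orbit h R φ).im = R * Real.cos φ - h / radius h (R * Real.sin φ) := rfl
  have hm := angleSpeed_pos h (R * Real.sin φ)
  have h3 := tau_mul_angleSpeed h (R * Real.sin φ)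
  have h4 := angleSpeed_sq hh (R * Real.sin φ)
  have h5 := tau_sq hh (R * Real.sin φ)
  have hp : 0 < radius h (R * Real.sin φ) ^ 2 + (orbit h R φ).im ^ 2 := by positivity
  simp only [Function.comp_apply]
  unfold arcSpeed
  generalize (orbit h R φ).im = v at *
  generalize curv h (orbit h R φ) = k at *
  generalize radius h (R * Real.sin φ) = w at *
  generalize angleSpeed h (R * Real.sin φ) = m at *
  generalize tau h (R * Real.sin φ) = t at *
  generalize R * Real.cos φ = u at *
  rw [← h3]
  clear hi hcont ht hr h3
  have hd : 0 < w ^ 4 + h ^ 2 := by positivity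
  have hu : u = v + h / w := by linarith
  have hc' : k * h * (w ^ 2 + v ^ 2) = w ^ 3 - h * v := by
    field_simp at hc; linarith
  have hl : h * (w ^ 2 + v ^ 2) * m * w / (w ^ 4 + h ^ 2) * k =
      (w ^ 3 - h * v) * m * w / (w ^ 4 + h ^ 2) := by rw [← hc']; ring
  rw [hl, hu]
  field_simp
  linear_combination (h + w * v) * h5

theorem orbit_add_two_pi (h R φ : ℝ) : orbit h R (φ + 2 * Real.pi) = orbit h R φ := by
  simp [orbit]

theorem arcSpeed_add_two_pi (h R φ : ℝ) : arcSpeed h R (φ + 2 * Real.pi) = arcSpeed h R φ := by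
  simp [arcSpeed, orbit]

theorem angle_add_two_pi {h : ℝ} (hh : 0 < h) (R φ : ℝ) :
    angle h R (φ + 2 * Real.pi) = angle h R φ + totalAngle h R := by
  have hcont : Continuous fun x => angleSpeed h (R * Real.sin x) :=
    (contDiff_angleSpeed hh).continuous.comp (by fun_prop)
  have hper : Function.Periodic (fun x => angleSpeed h (R * Real.sin x)) (2 * Real.pi) := by
    intro x
    simp
  have h1 := hper.intervalIntegral_add_eq φ 0
  have h2 := intervalIntegral.integral_add_adjacent_intervals
    (hcont.intervalIntegrable (μ := MeasureTheory.volume) 0 φ)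
    (hcont.intervalIntegrable φ (φ + 2 * Real.pi))
  rw [zero_add] at h1
  simp only [angle, totalAngle, Real.sin_add_two_pi]
  rw [← h2, h1]
  ring

/-! ### Arc length parametrization and model curves -/

theorem contDiff_integral {f : ℝ → ℝ} (hf : ContDiff ℝ ∞ f) :
    ContDiff ℝ ∞ fun x => ∫ t in (0 : ℝ)..x, f t := by
  rw [contDiff_infty_iff_deriv]
  have h1 : ∀ x, HasDerivAt (fun x => ∫ t in (0 : ℝ)..x, f t) (f x) x := fun x =>
    (hf.continuous.integral_hasStrictDerivAt 0 x).hasDerivAt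
  refine ⟨fun x => (h1 x).differentiableAt, ?_⟩
  rwa [funext fun x => (h1 x).deriv]

theorem contDiff_orbit_im {h : ℝ} (hh : 0 < h) (R : ℝ) :
    ContDiff ℝ ∞ fun φ => (orbit h R φ).im := by
  simp only [orbit]
  have hr : ContDiff ℝ ∞ fun φ => radius h (R * Real.sin φ) :=
    (contDiff_radius hh).comp (contDiff_const.mul Real.contDiff_sin)
  exact (contDiff_const.mul Real.contDiff_cos).sub
    (contDiff_const.div hr fun φ => (radius_pos hh _).ne')

theorem contDiff_arcSpeed {h : ℝ} (hh : 0 < h) (R : ℝ) : ContDiff ℝ ∞ (arcSpeed h R) := by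
  unfold arcSpeed
  have hs : ContDiff ℝ ∞ fun φ => R * Real.sin φ := contDiff_const.mul Real.contDiff_sin
  have hr : ContDiff ℝ ∞ fun φ => radius h (R * Real.sin φ) := (contDiff_radius hh).comp hs
  have hm : ContDiff ℝ ∞ fun φ => angleSpeed h (R * Real.sin φ) :=
    (contDiff_angleSpeed hh).comp hs
  refine ContDiff.div (((contDiff_const.mul ((hr.pow 2).add ((contDiff_orbit_im hh R).pow 2))).mul
    hm).mul hr) ((hr.pow 4).add contDiff_const) fun φ => ?_
  have := radius_pos hh (R * Real.sin φ)
  positivity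

theorem contDiff_angle {h : ℝ} (hh : 0 < h) (R : ℝ) : ContDiff ℝ ∞ (angle h R) := by
  unfold angle
  have hs : ContDiff ℝ ∞ fun φ => R * Real.sin φ := contDiff_const.mul Real.contDiff_sin
  have hr : ContDiff ℝ ∞ fun φ => radius h (R * Real.sin φ) := (contDiff_radius hh).comp hs
  exact (contDiff_integral ((contDiff_angleSpeed hh).comp hs)).sub
    (((contDiff_tau hh).comp hs).div (contDiff_const.mul hr) fun φ =>
      mul_ne_zero hh.ne' (radius_pos hh _).ne')

/-- A positive periodic speed is the inverse speed of a global reparametrization. -/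
theorem exists_reparametrization {f : ℝ → ℝ} (hf : ContDiff ℝ ∞ f) (hpos : ∀ x, 0 < f x) {T : ℝ}
    (hT : 0 < T) (hper : Function.Periodic f T) :
    ∃ (φ : ℝ → ℝ) (P : ℝ), 0 < P ∧ ContDiff ℝ ∞ φ ∧ (∀ s, HasDerivAt φ (f (φ s))⁻¹ s) ∧
      StrictMono φ ∧ Function.Surjective φ ∧ ∀ s, φ (s + P) = φ s + T := by
  set σ : ℝ → ℝ := fun x => ∫ t in (0 : ℝ)..x, f t with hσ
  have hd : ∀ x, HasDerivAt σ (f x) x := fun x =>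
    (hf.continuous.integral_hasStrictDerivAt 0 x).hasDerivAt
  have hσs : ContDiff ℝ ∞ σ := contDiff_integral hf
  have hmono : StrictMono σ := strictMono_of_hasDerivAt_pos hd hpos
  have hint : ∀ a b, IntervalIntegrable f MeasureTheory.volume a b := fun a b =>
    hf.continuous.intervalIntegrable a b
  have hP : 0 < ∫ t in (0 : ℝ)..T, f t :=
    intervalIntegral.intervalIntegral_pos_of_pos (hint _ _) hpos hT
  have hsurj : Function.Surjective σ := by
    refine hσs.continuous.surjective ?_ ?_
    · exact hper.tendsto_atTop_intervalIntegral_of_pos hP hT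
    · exact hper.tendsto_atBot_intervalIntegral_of_pos hP hT
  have hadd : ∀ x, σ (x + T) = σ x + ∫ t in (0 : ℝ)..T, f t := by
    intro x
    have h1 := hper.intervalIntegral_add_eq x 0
    rw [zero_add] at h1
    rw [← h1]
    exact (intervalIntegral.integral_add_adjacent_intervals (hint 0 x) (hint _ _)).symm
  -- The phase is the inverse of arc length σ; its period in s is the integral of `f` over one
  -- period.
  let e : ℝ ≃ₜ ℝ := (hmono.orderIsoOfSurjective σ hsurj).toHomeomorph
  have he : ∀ x, e x = σ x := fun x => rfl
  refine ⟨e.symm, _, hP, e.contDiff_symm_deriv (fun x => (hpos x).ne') hd hσs, ?_,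
    (hmono.orderIsoOfSurjective σ hsurj).symm.strictMono, e.symm.surjective, ?_⟩
  · intro s
    exact HasDerivAt.of_local_left_inverse e.symm.continuous.continuousAt (hd _) (hpos _).ne'
      (Filter.Eventually.of_forall e.apply_symm_apply)
  · intro s
    apply e.injective
    rw [e.apply_symm_apply, he, hadd, ← he, e.apply_symm_apply]

/-- `X` is the generating curve with phase `φ`, tangent angle `θ` and amplitude `R`, whose shape
has period `P`. -/
structure IsModel (h R : ℝ) (X : ℝ → ℂ) (φ θ : ℝ → ℝ) (P : ℝ) : Prop where
  smooth : ContDiff ℝ ∞ X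
  pos : 0 < P
  continuous_phase : Continuous φ
  strictMono_phase : StrictMono φ
  surjective_phase : Function.Surjective φ
  phase_add : ∀ s, φ (s + P) = φ s + 2 * Real.pi
  angle_add : ∀ s, θ (s + P) = θ s + totalAngle h R
  hasDerivAt_angle : ∀ s, HasDerivAt θ (curv h (orbit h R (φ s))) s
  hasDerivAt : ∀ s, HasDerivAt X (exp (θ s * I)) s
  eq_mul : ∀ s, X s = orbit h R (φ s) * exp (θ s * I)
  hasDerivAt_orbit : ∀ s, HasDerivAt (fun s => orbit h R (φ s))
    (1 - I * curv h (orbit h R (φ s)) * orbit h R (φ s)) s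

theorem exists_isModel {h : ℝ} (hh : 0 < h) (R : ℝ) : ∃ X φ θ P, IsModel h R X φ θ P := by
  obtain ⟨φ, P, hP, hφs, hφd, hmono, hsurj, hadd⟩ := exists_reparametrization
    (contDiff_arcSpeed hh R) (arcSpeed_pos hh R) Real.two_pi_pos (arcSpeed_add_two_pi h R)
  have hz : ∀ s, HasDerivAt (fun s => orbit h R (φ s))
      (1 - I * curv h (orbit h R (φ s)) * orbit h R (φ s)) s := by
    intro s
    refine ((hasDerivAt_orbit hh R (φ s)).scomp s (hφd s)).congr_deriv ?_
    have := (arcSpeed_pos hh R (φ s)).ne'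
    rw [real_smul, ← mul_assoc, ← ofReal_mul, inv_mul_cancel₀ this, ofReal_one, one_mul]
  have hθ : ∀ s, HasDerivAt (fun s => angle h R (φ s)) (curv h (orbit h R (φ s))) s := by
    intro s
    refine ((hasDerivAt_angle hh R (φ s)).comp s (hφd s)).congr_deriv ?_
    have := (arcSpeed_pos hh R (φ s)).ne'
    field_simp
  have hX : ∀ s, HasDerivAt (fun s => orbit h R (φ s) * exp ((angle h R (φ s) : ℝ) * I))
      (exp ((angle h R (φ s) : ℝ) * I)) s := by
    intro s
    refine ((hz s).mul (((hθ s).ofReal_comp.mul_const I).cexp)).congr_deriv ?_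
    ring
  refine ⟨_, φ, fun s => angle h R (φ s), P, ?_, hP, hφs.continuous, hmono, hsurj, hadd, ?_, hθ,
    hX, fun s => rfl, hz⟩
  · rw [contDiff_infty_iff_deriv]
    refine ⟨fun s => (hX s).differentiableAt, ?_⟩
    rw [funext fun s => (hX s).deriv]
    exact ((ofRealCLM.contDiff.comp ((contDiff_angle hh R).comp hφs)).mul contDiff_const).cexp
  · intro s
    simp only [hadd, angle_add_two_pi hh]

/-! ### Monotonicity and range of the total angle -/

theorem angleSpeed_lt_angleSpeed {h : ℝ} (hh : 0 < h) {x y : ℝ} (hxy : |x| < |y|) :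
    angleSpeed h y < angleSpeed h x := by
  have h1 := radius_lt_radius hh hxy
  have h2 := radius_pos hh x
  unfold angleSpeed
  refine Real.sqrt_lt_sqrt (by positivity) ?_
  gcongr

theorem angleSpeed_abs (h x : ℝ) : angleSpeed h |x| = angleSpeed h x := by
  simp [angleSpeed, radius]

theorem angleSpeed_le_angleSpeed {h : ℝ} (hh : 0 < h) {x y : ℝ} (hxy : |x| ≤ |y|) :
    angleSpeed h y ≤ angleSpeed h x := by
  rcases hxy.lt_or_eq with h1 | h1
  · exact (angleSpeed_lt_angleSpeed hh h1).le
  · rw [← angleSpeed_abs h x, h1, angleSpeed_abs]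

theorem angleSpeed_zero {h : ℝ} (hh : 0 < h) : angleSpeed h 0 = √(h ^ 2 + 1) / h := by
  rw [angleSpeed, radius_zero hh, ← Real.sqrt_sq hh.le, ← Real.sqrt_div (by positivity),
    Real.sqrt_sq hh.le]
  congr 1
  field_simp

theorem continuous_angleSpeed_mul_sin {h : ℝ} (hh : 0 < h) (R : ℝ) :
    Continuous fun x => angleSpeed h (R * Real.sin x) :=
  (contDiff_angleSpeed hh).continuous.comp (by fun_prop)

/-- The integrand decreases pointwise in the amplitude, strictly at φ = π/2. -/
theorem totalAngle_lt {h : ℝ} (hh : 0 < h) {R S : ℝ} (hR : 0 ≤ R) (hRS : R < S) :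
    totalAngle h S < totalAngle h R := by
  refine intervalIntegral.integral_lt_integral_of_continuousOn_of_le_of_exists_lt Real.two_pi_pos
    (continuous_angleSpeed_mul_sin hh S).continuousOn
    (continuous_angleSpeed_mul_sin hh R).continuousOn ?_
    ⟨Real.pi / 2, ⟨by positivity, by linarith [Real.pi_pos]⟩, ?_⟩
  · intro x _
    apply angleSpeed_le_angleSpeed hh
    rw [abs_mul, abs_mul, abs_of_nonneg hR, abs_of_pos (hR.trans_lt hRS)]
    gcongr
  · apply angleSpeed_lt_angleSpeed hh
    rw [Real.sin_pi_div_two, mul_one, mul_one, abs_of_nonneg hR, abs_of_pos (hR.trans_lt hRS)]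
    exact hRS

theorem totalAngle_lt_iff {h : ℝ} (hh : 0 < h) {R S : ℝ} (hR : 0 ≤ R) (hS : 0 ≤ S) :
    totalAngle h S < totalAngle h R ↔ R < S := by
  refine ⟨fun H => ?_, totalAngle_lt hh hR⟩
  by_contra! hle
  rcases hle.lt_or_eq with h1 | h1
  · exact (totalAngle_lt hh hS h1).not_gt H
  · exact H.ne (by rw [h1])

theorem totalAngle_inj {h : ℝ} (hh : 0 < h) {R S : ℝ} (hR : 0 ≤ R) (hS : 0 ≤ S) :
    totalAngle h R = totalAngle h S ↔ R = S := by
  refine ⟨fun H => ?_, fun H => by rw [H]⟩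
  rcases lt_trichotomy R S with h1 | h1 | h1
  · exact absurd H (totalAngle_lt hh hR h1).ne'
  · exact h1
  · exact absurd H (totalAngle_lt hh hS h1).ne

theorem totalAngle_zero {h : ℝ} (hh : 0 < h) :
    totalAngle h 0 = 2 * Real.pi * (√(h ^ 2 + 1) / h) := by
  simp [totalAngle, angleSpeed_zero hh, mul_div_assoc]

theorem continuous_totalAngle {h : ℝ} (hh : 0 < h) : Continuous (totalAngle h) := by
  unfold totalAngle
  refine intervalIntegral.continuous_parametric_intervalIntegral_of_continuous' ?_ _ _
  have : Continuous fun p : ℝ × ℝ => p.1 * Real.sin p.2 := by fun_prop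
  exact (contDiff_angleSpeed hh).continuous.comp this

theorem tendsto_angleSpeed {h : ℝ} (hh : 0 < h) :
    Filter.Tendsto (angleSpeed h) Filter.atTop (nhds 1) := by
  have h1 : Filter.Tendsto (fun x : ℝ => (h ^ 2 - 1 + x ^ 2) / 2) Filter.atTop Filter.atTop :=
    (Filter.tendsto_atTop_add_const_left _ _
      (Filter.tendsto_pow_atTop two_ne_zero)).atTop_div_const two_pos
  have h2 : Filter.Tendsto (fun x : ℝ => radius h x ^ 2) Filter.atTop Filter.atTop := by
    refine Filter.tendsto_atTop_mono (fun x => ?_) h1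
    have h3 : radius h x ^ 2 = _ := Real.sq_sqrt (half_pos (radius_arg_pos hh x)).le
    rw [h3]
    have := Real.sqrt_nonneg ((h ^ 2 - 1 + x ^ 2) ^ 2 + 4 * h ^ 2)
    linarith
  have h3 := ((tendsto_const_nhds (x := (1 : ℝ))).add (h2.const_div_atTop 1)).sqrt
  unfold angleSpeed
  simpa using h3

theorem sin_ne_zero_of_mem_Ioc {x : ℝ} (hx : x ∈ Set.Ioc 0 (2 * Real.pi)) (h1 : x ≠ Real.pi)
    (h2 : x ≠ 2 * Real.pi) : Real.sin x ≠ 0 := by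
  rcases h1.lt_or_gt with h | h
  · exact (Real.sin_pos_of_pos_of_lt_pi hx.1 h).ne'
  · have := Real.sin_pos_of_pos_of_lt_pi (x := x - Real.pi) (by linarith)
      (by linarith [lt_of_le_of_ne hx.2 h2])
    rw [Real.sin_sub_pi] at this
    linarith

/-- Dominated convergence, with the maximum `angleSpeed h 0` as bound: off the null set where sin
vanishes, R|sin x| → ∞ and the integrand tends to 1. -/
theorem tendsto_totalAngle {h : ℝ} (hh : 0 < h) :
    Filter.Tendsto (totalAngle h) Filter.atTop (nhds (2 * Real.pi)) := by
  have h1 : Filter.Tendsto (totalAngle h) Filter.atTop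
      (nhds (∫ _ in (0 : ℝ)..(2 * Real.pi), (1 : ℝ))) := by
    refine intervalIntegral.tendsto_integral_filter_of_dominated_convergence
      (fun _ => angleSpeed h 0) (Filter.Eventually.of_forall fun R =>
        (continuous_angleSpeed_mul_sin hh R).aestronglyMeasurable)
      (Filter.Eventually.of_forall fun R => Filter.Eventually.of_forall fun x _ => ?_)
      intervalIntegrable_const ?_
    · rw [Real.norm_of_nonneg (angleSpeed_pos h _).le]
      exact angleSpeed_le_angleSpeed hh (by simpa using by positivity)
    · filter_upwards [MeasureTheory.Measure.ae_ne MeasureTheory.volume Real.pi,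
        MeasureTheory.Measure.ae_ne MeasureTheory.volume (2 * Real.pi)] with x hx1 hx2 hx
      rw [Set.uIoc_of_le Real.two_pi_pos.le] at hx
      have hs := abs_pos.2 (sin_ne_zero_of_mem_Ioc hx hx1 hx2)
      have h2 := (tendsto_angleSpeed hh).comp (Filter.tendsto_id.atTop_mul_const hs)
      refine h2.congr' ?_
      filter_upwards [Filter.eventually_ge_atTop 0] with R hR
      rw [← angleSpeed_abs h (R * Real.sin x), abs_mul, abs_of_nonneg hR]
      rfl
  simpa using h1

theorem exists_totalAngle_eq {h : ℝ} (hh : 0 < h) {r : ℝ} (h1 : 1 < r) (h2 : r < √(h ^ 2 + 1) / h) :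
    ∃ R, 0 < R ∧ totalAngle h R = 2 * Real.pi * r := by
  have hpi := Real.two_pi_pos
  have h3 : 2 * Real.pi < 2 * Real.pi * r := by nlinarith
  have h4 : 2 * Real.pi * r < totalAngle h 0 := by
    rw [totalAngle_zero hh]
    gcongr
  obtain ⟨S, hS, hS0⟩ := (((tendsto_totalAngle hh).eventually_lt_const h3).and
    (Filter.eventually_ge_atTop 0)).exists
  obtain ⟨R, hR, hRe⟩ := intermediate_value_Icc' hS0 (continuous_totalAngle hh).continuousOn
    ⟨hS.le, h4.le⟩
  refine ⟨R, lt_of_le_of_ne hR.1 ?_, hRe⟩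
  rintro rfl
  exact h4.ne' hRe

/-! ### The critical amplitude and the elliptic integral -/

/-- The distance from the origin on the orbit of amplitude `1`. -/
noncomputable def criticalDist (h φ : ℝ) : ℝ :=
  √(-(2 * h * (orbit h 1 φ).im / radius h (Real.sin φ)))

/-- The squared distance from the origin along an orbit. -/
theorem orbit_sq {h : ℝ} (hh : 0 < h) (R φ : ℝ) :
    (orbit h R φ).re ^ 2 + (orbit h R φ).im ^ 2 +
      2 * h * (orbit h R φ).im / radius h (R * Real.sin φ) = R ^ 2 - 1 := by
  have h1 := tau_mul_angleSpeed h (R * Real.sin φ)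
  have h2 := tau_sq hh (R * Real.sin φ)
  have h3 := angleSpeed_sq hh (R * Real.sin φ)
  have h4 := radius_pos hh (R * Real.sin φ)
  have h6 := Real.sin_sq_add_cos_sq φ
  have h5 : tau h (R * Real.sin φ) ^ 2 * (radius h (R * Real.sin φ) ^ 2 + 1) =
      (R ^ 2 * (1 - Real.cos φ ^ 2)) * radius h (R * Real.sin φ) ^ 2 := by
    rw [← h3, ← h6]
    linear_combination (tau h (R * Real.sin φ) * angleSpeed h (R * Real.sin φ) + R * Real.sin φ) *
      radius h (R * Real.sin φ) ^ 2 * h1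
  simp only [orbit]
  generalize radius h (R * Real.sin φ) = w at *
  generalize tau h (R * Real.sin φ) = t at *
  field_simp
  linear_combination h5 - h2

theorem criticalDist_sq {h : ℝ} (hh : 0 < h) (φ : ℝ) :
    (orbit h 1 φ).re ^ 2 + (orbit h 1 φ).im ^ 2 = criticalDist h φ ^ 2 ∧
      criticalDist h φ ^ 2 = -(2 * h * (orbit h 1 φ).im / radius h (Real.sin φ)) := by
  have h1 := orbit_sq hh 1 φ
  rw [one_mul] at h1
  have h2 : criticalDist h φ ^ 2 = -(2 * h * (orbit h 1 φ).im / radius h (Real.sin φ)) :=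
    Real.sq_sqrt (by nlinarith [sq_nonneg (orbit h 1 φ).re, sq_nonneg (orbit h 1 φ).im])
  exact ⟨by linarith, h2⟩

/-- The polar angle on the critical curve, in terms of `arcsin` of half the distance. -/
noncomputable def polarAngle (h t : ℝ) : ℝ :=
  ∫ x in (0 : ℝ)..t, √(h ^ 2 + 4 * Real.sin x ^ 2) / h

theorem hasDerivAt_polarAngle (h t : ℝ) :
    HasDerivAt (polarAngle h) (√(h ^ 2 + 4 * Real.sin t ^ 2) / h) t := by
  have : Continuous fun x => √(h ^ 2 + 4 * Real.sin x ^ 2) / h := by fun_prop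
  exact (this.integral_hasStrictDerivAt 0 t).hasDerivAt

/-- The substitution x ↦ π/2 − x replaces 4 sin² by 4 cos² = 4 − 4 sin², which exposes the modulus
2/√(h² + 4). -/
theorem polarAngle_pi_div_two {h : ℝ} (hh : 0 < h) :
    polarAngle h (Real.pi / 2) =
      √(h ^ 2 + 4) / h * ellipticE (2 / √(h ^ 2 + 4)) := by
  have h1 := intervalIntegral.integral_comp_sub_left (a := 0) (b := Real.pi / 2)
    (fun x => √(h ^ 2 + 4 * Real.sin x ^ 2) / h) (Real.pi / 2)
  rw [sub_self, sub_zero] at h1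
  rw [polarAngle, ← h1, ellipticE, ← intervalIntegral.integral_const_mul]
  congr 1
  ext x
  have hp : 0 < h ^ 2 + 4 := by positivity
  rw [Real.sin_pi_div_two_sub, div_mul_eq_mul_div, ← Real.sqrt_mul hp.le, div_pow,
    Real.sq_sqrt hp.le]
  congr 2
  field_simp
  linear_combination 4 * Real.sin_sq_add_cos_sq x

theorem integral_angleSpeed_sin {h : ℝ} (hh : 0 < h) :
    ∫ φ in (0 : ℝ)..Real.pi, angleSpeed h (Real.sin φ) =
      polarAngle h (Real.pi / 2) + Real.pi / 2 := by
  -- An antiderivative found from X = ze^{iθ}. The first term is the polar angle of X at distance r,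
  -- with r = 2 sin t; the second is −arg z; together they give θ. The third undoes the exact term
  -- in `angle`.
  set F : ℝ → ℝ := fun φ => polarAngle h (Real.arcsin (criticalDist h φ / 2)) +
    Real.arcsin (criticalDist h φ * radius h (Real.sin φ) / (2 * h)) +
    tau h (Real.sin φ) / (h * radius h (Real.sin φ)) with hF
  have hradc : Continuous fun φ => radius h (Real.sin φ) :=
    (contDiff_radius hh).continuous.comp Real.continuous_sin
  have htauc : Continuous fun φ => tau h (Real.sin φ) :=
    (contDiff_tau hh).continuous.comp Real.continuous_sin
  have hdist : Continuous (criticalDist h) := by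
    unfold criticalDist
    exact ((((continuous_const.mul (contDiff_orbit_im hh 1).continuous)).div hradc
      fun φ => (radius_pos hh _).ne').neg).sqrt
  have hpol : Continuous (polarAngle h) :=
    continuous_iff_continuousAt.2 fun t => (hasDerivAt_polarAngle h t).continuousAt
  have hFc : Continuous F := by
    refine ((hpol.comp (Real.continuous_arcsin.comp (hdist.div_const 2))).add
      (Real.continuous_arcsin.comp ((hdist.mul hradc).div_const _))).add
      (htauc.div (continuous_const.mul hradc) fun φ => ?_)
    exact mul_ne_zero hh.ne' (radius_pos hh _).ne'
  have hF0 : F 0 = 0 := by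
    simp [hF, criticalDist, orbit, radius_zero hh, hh.ne', polarAngle, tau_zero]
  have hFpi : F Real.pi = polarAngle h (Real.pi / 2) + Real.pi / 2 := by
    have : criticalDist h Real.pi = 2 := by
      simp only [criticalDist, orbit, one_mul, Real.sin_pi, Real.cos_pi, radius_zero hh]
      rw [show -(2 * h * (-1 - h / h) / h) = 2 ^ 2 by field_simp; norm_num,
        Real.sqrt_sq zero_le_two]
    simp [hF, this, radius_zero hh, hh.ne', tau_zero]
  rw [intervalIntegral.integral_eq_sub_of_hasDerivAt_of_le (f := F) Real.pi_pos.le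
    hFc.continuousOn ?_ ?_, hF0, hFpi, sub_zero]
  · intro φ hφ
    have hs : 0 < Real.sin φ := Real.sin_pos_of_pos_of_lt_pi hφ.1 hφ.2
    obtain ⟨hr1, hr2⟩ := criticalDist_sq hh φ
    have hw := radius_pos hh (Real.sin φ)
    have ht : 0 < (orbit h 1 φ).re := by
      rw [orbit, one_mul]; exact tau_pos h hs
    have htw : (orbit h 1 φ).re ^ 2 + h ^ 2 = radius h (Real.sin φ) ^ 2 := by
      rw [orbit, one_mul]; exact tau_sq hh _
    have hrpos : 0 < criticalDist h φ := by
      refine lt_of_le_of_ne (Real.sqrt_nonneg _) fun h0 => ?_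
      rw [← h0] at hr1
      nlinarith [sq_nonneg (orbit h 1 φ).im]
    have hor := hasDerivAt_orbit hh 1 φ
    have hre := Complex.reCLM.hasFDerivAt.comp_hasDerivAt φ hor
    have him := Complex.imCLM.hasFDerivAt.comp_hasDerivAt φ hor
    have hla := arcSpeed_pos hh 1 φ
    have hdist_eq : criticalDist h = fun φ => √((orbit h 1 φ).re ^ 2 + (orbit h 1 φ).im ^ 2) := by
      funext φ
      rw [(criticalDist_sq hh φ).1]
      exact (Real.sqrt_sq (Real.sqrt_nonneg _)).symm
    -- Zero energy, r² = −2hν/w, identifies the two forms. The left one is continuous up to r = 0,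
    -- as the endpoint φ = 0 requires; the right one is easier to differentiate.
    have hsine : ∀ φ ∈ Set.Ioo 0 Real.pi, criticalDist h φ * radius h (Real.sin φ) / (2 * h) =
        -(orbit h 1 φ).im / criticalDist h φ := by
      intro φ hφ
      obtain ⟨hr1, hr2⟩ := criticalDist_sq hh φ
      have hw := radius_pos hh (Real.sin φ)
      have ht : 0 < (orbit h 1 φ).re := by
        rw [orbit, one_mul]; exact tau_pos h (Real.sin_pos_of_pos_of_lt_pi hφ.1 hφ.2)
      have h0 : criticalDist h φ ≠ 0 := fun h0 => by
        rw [h0] at hr1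
        nlinarith [sq_nonneg (orbit h 1 φ).im]
      rw [div_eq_div_iff (by positivity) h0]
      field_simp at hr2
      linear_combination hr2
    have hangd := hasDerivAt_angle hh 1 φ
    have hint := ((continuous_angleSpeed_mul_sin hh 1).integral_hasStrictDerivAt 0 φ).hasDerivAt
    -- By definition of `angle` this term is the integral minus the tangent angle, so no new
    -- differentiation is needed.
    have hthird : HasDerivAt (fun φ => tau h (Real.sin φ) / (h * radius h (Real.sin φ)))
        (angleSpeed h (Real.sin φ) - arcSpeed h 1 φ * curv h (orbit h 1 φ)) φ := by
      have := hint.sub hangd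
      simp only [one_mul] at this
      refine this.congr_of_eventuallyEq (Filter.Eventually.of_forall fun y => ?_)
      simp [angle]
    have hre' : HasDerivAt (fun φ => (orbit h 1 φ).re)
        (arcSpeed h 1 φ * (1 + curv h (orbit h 1 φ) * (orbit h 1 φ).im)) φ :=
      hre.congr_deriv (by simp)
    have him' : HasDerivAt (fun φ => (orbit h 1 φ).im)
        (-(arcSpeed h 1 φ * (curv h (orbit h 1 φ) * (orbit h 1 φ).re))) φ :=
      him.congr_deriv (by simp)
    clear hre him
    have hrd : HasDerivAt (criticalDist h)
        (arcSpeed h 1 φ * (orbit h 1 φ).re / criticalDist h φ) φ := by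
      have h1 := ((hre'.pow 2).add (him'.pow 2)).sqrt
        (show (orbit h 1 φ).re ^ 2 + (orbit h 1 φ).im ^ 2 ≠ 0 by positivity)
      have h2 : √((orbit h 1 φ).re ^ 2 + (orbit h 1 φ).im ^ 2) = criticalDist h φ := by
        rw [hdist_eq]
      rw [hdist_eq]
      refine HasDerivAt.congr_deriv h1 ?_
      simp only [Pi.add_apply, Pi.pow_apply, h2]
      rw [div_eq_div_iff (by positivity) (by positivity)]
      simp
      ring
    -- Eliminates ν between |z|² = r² and zero energy. It yields r < 2 for τ ≠ 0, and its square
    -- root relates the derivative of the polar angle to that of arcsin(r/2).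
    have hBsq : (h ^ 2 + criticalDist h φ ^ 2) * (orbit h 1 φ).re ^ 2 =
        criticalDist h φ ^ 2 * radius h (Real.sin φ) ^ 2 * (1 - (criticalDist h φ / 2) ^ 2) := by
      have h1 := hr2
      field_simp at h1
      rw [← htw]
      have h2 : criticalDist h φ ^ 4 * ((orbit h 1 φ).re ^ 2 + h ^ 2) =
          4 * h ^ 2 * (orbit h 1 φ).im ^ 2 := by
        rw [htw]
        linear_combination (criticalDist h φ ^ 2 * radius h (Real.sin φ) -
          2 * h * (orbit h 1 φ).im) * h1
      linear_combination h ^ 2 * hr1 + h2 / 4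
    have hBpos : 0 < 1 - (criticalDist h φ / 2) ^ 2 := by
      by_contra! hle
      have h1 : 0 < (h ^ 2 + criticalDist h φ ^ 2) * (orbit h 1 φ).re ^ 2 := by positivity
      have h2 : 0 < criticalDist h φ ^ 2 * radius h (Real.sin φ) ^ 2 := by positivity
      nlinarith
    have hcos : √(1 - (-(orbit h 1 φ).im / criticalDist h φ) ^ 2) =
        (orbit h 1 φ).re / criticalDist h φ := by
      have h1 : 1 - (-(orbit h 1 φ).im / criticalDist h φ) ^ 2 =
          ((orbit h 1 φ).re / criticalDist h φ) ^ 2 := by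
        field_simp
        linear_combination -hr1
      rw [h1, Real.sqrt_sq (by positivity)]
    have hlt : |(-(orbit h 1 φ).im / criticalDist h φ)| < 1 := by
      rw [← sq_lt_one_iff_abs_lt_one, div_pow, div_lt_one (by positivity), ← hr1]
      nlinarith
    have hfirst := (hasDerivAt_polarAngle h (Real.arcsin (criticalDist h φ / 2))).comp φ
      ((Real.hasDerivAt_arcsin (by intro h0; rw [h0] at hBpos; norm_num at hBpos)
        (by intro h0; rw [h0] at hBpos; norm_num at hBpos)).comp φ (hrd.div_const 2))
    have hsecond := (Real.hasDerivAt_arcsin (abs_lt.1 hlt).1.ne' (abs_lt.1 hlt).2.ne).comp φ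
      (him'.neg.div hrd hrpos.ne')
    have hsecond' := hsecond.congr_of_eventuallyEq (f₁ := fun φ =>
      Real.arcsin (criticalDist h φ * radius h (Real.sin φ) / (2 * h)))
      (by filter_upwards [Ioo_mem_nhds hφ.1 hφ.2] with y hy
          rw [hsine y hy]; rfl)
    refine HasDerivAt.congr_deriv ((hfirst.add hsecond').add hthird) ?_
    have hA : √(h ^ 2 + 4 * Real.sin (Real.arcsin (criticalDist h φ / 2)) ^ 2) *
        (orbit h 1 φ).re = criticalDist h φ * radius h (Real.sin φ) *
          √(1 - (criticalDist h φ / 2) ^ 2) := by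
      have hlt2 : |criticalDist h φ / 2| < 1 := by
        rw [← sq_lt_one_iff_abs_lt_one]; linarith
      rw [Real.sin_arcsin (abs_lt.1 hlt2).1.le (abs_lt.1 hlt2).2.le,
        ← pow_left_inj₀ (by positivity) (by positivity) two_ne_zero, mul_pow, mul_pow, mul_pow,
        Real.sq_sqrt (by positivity), Real.sq_sqrt hBpos.le, ← hBsq]
      ring
    have hB : 0 < √(1 - (criticalDist h φ / 2) ^ 2) := Real.sqrt_pos.2 hBpos
    simp only [Pi.neg_apply]
    rw [hcos]
    generalize √(h ^ 2 + 4 * Real.sin (Real.arcsin (criticalDist h φ / 2)) ^ 2) = A at *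
    generalize √(1 - (criticalDist h φ / 2) ^ 2) = B at *
    clear hfirst hsecond hsecond' hthird hrd hre' him' hint hangd hor hsine hdist_eq hlt
    generalize criticalDist h φ = r at *
    generalize curv h (orbit h 1 φ) = k at *
    generalize orbit h 1 φ = z at *
    generalize arcSpeed h 1 φ = l at *
    generalize radius h (Real.sin φ) = w at *
    have h1 := hr2
    field_simp at h1
    have h2 : A * z.re * r + 2 * h * z.im * B = 0 := by
      rw [hA]
      linear_combination B * h1
    field_simp
    linear_combination l * h2
  · have := continuous_angleSpeed_mul_sin hh 1
    simp only [one_mul] at this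
    exact this.intervalIntegrable _ _

/-- The integrand is even in sin φ, so both half-periods contribute equally. -/
theorem totalAngle_one {h : ℝ} (hh : 0 < h) :
    totalAngle h 1 = 2 * Real.pi * criticalRatio h := by
  have hcont := continuous_angleSpeed_mul_sin hh 1
  have hadj := intervalIntegral.integral_add_adjacent_intervals
    (hcont.intervalIntegrable (μ := MeasureTheory.volume) 0 Real.pi)
    (hcont.intervalIntegrable Real.pi (2 * Real.pi))
  have hshift := intervalIntegral.integral_comp_add_right (a := 0) (b := Real.pi)
    (fun x => angleSpeed h (1 * Real.sin x)) Real.pi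
  have heven : ∀ x, angleSpeed h (-x) = angleSpeed h x := fun x => by
    rw [← angleSpeed_abs, abs_neg, angleSpeed_abs]
  simp only [one_mul, Real.sin_add_pi, heven, zero_add, ← two_mul] at hshift hadj
  rw [totalAngle]
  simp only [one_mul]
  rw [← hadj, ← hshift, integral_angleSpeed_sin hh, polarAngle_pi_div_two hh, criticalRatio]
  have := Real.pi_pos
  field_simp
  ring

/-! ### Every generating curve is a rotated model curve -/

theorem conj_mul_self_of_norm_one {w : ℂ} (hw : ‖w‖ = 1) : (starRingEnd ℂ) w * w = 1 := by
  rw [mul_comm, Complex.mul_conj, Complex.normSq_eq_norm_sq, hw]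
  norm_num

/-- The moving frame of a generating curve. -/
theorem exists_frame {h : ℝ} (hh : 0 < h) {X : ℝ → ℂ} (hX : ContDiff ℝ ∞ X)
    (hn : ∀ s, ‖deriv X s‖ = 1)
    (hH : ∀ s t, meanCurvature (helicoidalSurface h X) s t = 1) :
    ∃ z : ℝ → ℂ, (∀ s, X s = z s * deriv X s) ∧
      (∀ s, HasDerivAt (deriv X) (curv h (z s) * I * deriv X s) s) ∧
      ∀ s, HasDerivAt z (1 - I * curv h (z s) * z s) s := by
  have hXd : ∀ s, HasDerivAt X (deriv X s) s := fun s =>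
    (hX.differentiable (by simp) s).hasDerivAt
  have hTd : ∀ s, HasDerivAt (deriv X) (deriv (deriv X) s) s := fun s =>
    ((contDiff_infty_iff_deriv.1 hX).2.differentiable (by simp) s).hasDerivAt
  have hz : ∀ s, X s = X s * (starRingEnd ℂ) (deriv X s) * deriv X s := fun s => by
    rw [mul_assoc, conj_mul_self_of_norm_one (hn s), mul_one]
  have hk : ∀ s, deriv (deriv X) s =
      curv h (X s * (starRingEnd ℂ) (deriv X s)) * I * deriv X s := by
    intro s
    obtain ⟨k, hk⟩ := exists_curvature hX hn s
    rw [hk]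
    have h1 := meanCurvature_helicoidalSurface hh hXd hTd s 0 (hn s) (hz s) hk
    rw [hH] at h1
    rw [(meanCurvature_eq_one_iff hh _ _).1 h1.symm]
  refine ⟨fun s => X s * (starRingEnd ℂ) (deriv X s), hz, fun s => ?_, fun s => ?_⟩
  · rw [← hk]; exact hTd s
  · have h1 := (hXd s).mul ((hTd s).star)
    refine HasDerivAt.congr_deriv h1 ?_
    have h2 := conj_mul_self_of_norm_one (hn s)
    rw [Complex.star_def, hk s]
    simp only [map_mul, Complex.conj_I, Complex.conj_ofReal]
    linear_combination h2

/-- The conserved quantity of the motion of the origin in the moving frame. -/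
noncomputable def energy (h : ℝ) (z : ℂ) : ℝ :=
  z.re ^ 2 + z.im ^ 2 + 2 * h * z.im / √(z.re ^ 2 + h ^ 2)

theorem energy_eq {h : ℝ} (hh : 0 < h) {z : ℝ → ℂ}
    (hz : ∀ s, HasDerivAt z (1 - I * curv h (z s) * z s) s) (s t : ℝ) :
    energy h (z s) = energy h (z t) := by
  suffices hd : ∀ s, HasDerivAt (fun s => energy h (z s)) 0 s from
    is_const_of_deriv_eq_zero (fun s => (hd s).differentiableAt) (fun s => (hd s).deriv) s t
  intro s
  have hre : HasDerivAt (fun s => (z s).re) (1 + curv h (z s) * (z s).im) s :=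
    (Complex.reCLM.hasFDerivAt.comp_hasDerivAt s (hz s)).congr_deriv (by simp)
  have him : HasDerivAt (fun s => (z s).im) (-(curv h (z s) * (z s).re)) s :=
    (Complex.imCLM.hasFDerivAt.comp_hasDerivAt s (hz s)).congr_deriv (by simp)
  have hpos : 0 < (z s).re ^ 2 + h ^ 2 := by positivity
  have hW := Real.sqrt_pos.2 hpos
  refine HasDerivAt.congr_deriv (((hre.pow 2).add (him.pow 2)).add
    ((him.const_mul (2 * h)).div (((hre.pow 2).add_const (h ^ 2)).sqrt hpos.ne') hW.ne')) ?_
  have hW2 := Real.sq_sqrt hpos.le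
  have hk : curv h (z s) * ((z s).re ^ 2 + (z s).im ^ 2 + h ^ 2) =
      √((z s).re ^ 2 + h ^ 2) ^ 3 / h - (z s).im := div_mul_cancel₀ _ (by positivity)
  simp only [Pi.pow_apply]
  generalize curv h (z s) = k at *
  generalize √((z s).re ^ 2 + h ^ 2) = w at *
  generalize z s = y at *
  field_simp at hk ⊢
  linear_combination -2 * y.re * hk - 2 * y.re * k * h * hW2

/-- Since h ≤ w, the energy is at least ‖z‖² − 2‖z‖, so a solution stays in a ball fixed by its
energy. -/
theorem norm_le_of_energy {h : ℝ} (hh : 0 < h) (z : ℂ) : ‖z‖ ≤ |energy h z| + 3 := by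
  have h1 := Complex.sq_norm z
  rw [Complex.normSq_apply] at h1
  have h2 : |z.im| ≤ ‖z‖ := Complex.abs_im_le_norm z
  have hw : h ≤ √(z.re ^ 2 + h ^ 2) := Real.le_sqrt_of_sq_le (by nlinarith [sq_nonneg z.re])
  have h3 : -(2 * ‖z‖) ≤ 2 * h * z.im / √(z.re ^ 2 + h ^ 2) := by
    rw [le_div_iff₀ (hh.trans_le hw)]
    nlinarith [neg_abs_le z.im, norm_nonneg z]
  have h4 : energy h z ≤ |energy h z| := le_abs_self _
  have h5 := abs_nonneg (energy h z)
  have h6 : energy h z = z.re ^ 2 + z.im ^ 2 + 2 * h * z.im / √(z.re ^ 2 + h ^ 2) := rfl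
  by_contra! hlt
  nlinarith

theorem contDiff_frameField {h : ℝ} (hh : 0 < h) :
    ContDiff ℝ ∞ fun z : ℂ => 1 - I * curv h z * z := by
  have hre : ContDiff ℝ ∞ Complex.re := Complex.reCLM.contDiff
  have him : ContDiff ℝ ∞ Complex.im := Complex.imCLM.contDiff
  have hc : ContDiff ℝ ∞ (curv h) := by
    unfold curv
    refine ContDiff.div (((ContDiff.sqrt ((hre.pow 2).add contDiff_const) fun z => ?_).pow 3
      |>.div_const h).sub him) (((hre.pow 2).add (him.pow 2)).add contDiff_const) fun z => ?_
    · positivity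
    · positivity
  exact contDiff_const.sub
    ((contDiff_const.mul (Complex.ofRealCLM.contDiff.comp hc)).mul contDiff_id)

/-- Uniqueness for the motion of the origin in the moving frame. -/
theorem frame_unique {h : ℝ} (hh : 0 < h) {y z : ℝ → ℂ}
    (hy : ∀ s, HasDerivAt y (1 - I * curv h (y s) * y s) s)
    (hz : ∀ s, HasDerivAt z (1 - I * curv h (z s) * z s) s) (h0 : y 0 = z 0) : y = z := by
  -- The smooth field is Lipschitz on this ball, and conservation of energy keeps both solutions
  -- inside it for all time.
  obtain ⟨K, hK⟩ := (contDiff_frameField hh).contDiffOn.exists_lipschitzOnWith (by simp)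
    (convex_closedBall (0 : ℂ) (|energy h (y 0)| + 3)) (isCompact_closedBall _ _)
  refine ODE_solution_unique_univ (v := fun _ z => 1 - I * curv h z * z) (t₀ := 0)
    (fun _ => hK) (fun t => ⟨hy t, ?_⟩) (fun t => ⟨hz t, ?_⟩) h0
  · rw [mem_closedBall_zero_iff, energy_eq hh hy 0 t]
    exact norm_le_of_energy hh _
  · rw [mem_closedBall_zero_iff, h0, energy_eq hh hz 0 t]
    exact norm_le_of_energy hh _

theorem eq_radius {h x w : ℝ} (hh : 0 < h) (hw : 0 < w)
    (hq : w ^ 4 + (1 - h ^ 2 - x ^ 2) * w ^ 2 - h ^ 2 = 0) : radius h x = w := by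
  have h1 := radius_quartic hh x
  have h2 := radius_pos hh x
  have key : (radius h x ^ 2 - w ^ 2) * (radius h x ^ 2 * w ^ 2 + h ^ 2) = 0 := by
    linear_combination w ^ 2 * h1 - radius h x ^ 2 * hq
  have h3 := (mul_eq_zero.1 key).resolve_right (by positivity)
  exact (pow_left_inj₀ h2.le hw.le two_ne_zero).1 (sub_eq_zero.1 h3)

/-- Every point lies on some orbit. -/
theorem exists_orbit_eq {h : ℝ} (hh : 0 < h) (z : ℂ) : ∃ R φ, 0 ≤ R ∧ orbit h R φ = z := by
  have hpos : 0 < z.re ^ 2 + h ^ 2 := by positivity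
  obtain ⟨w, hw, hw2⟩ : ∃ w, 0 < w ∧ w ^ 2 = z.re ^ 2 + h ^ 2 :=
    ⟨_, Real.sqrt_pos.2 hpos, Real.sq_sqrt hpos.le⟩
  obtain ⟨m, hm, hm2⟩ : ∃ m, 0 < m ∧ √(1 + 1 / w ^ 2) = m :=
    ⟨_, Real.sqrt_pos.2 (by positivity), rfl⟩
  have hmw : m ^ 2 * w ^ 2 = w ^ 2 + 1 := by
    rw [← hm2, Real.sq_sqrt (by positivity)]
    field_simp
  -- These are the circle coordinates of z: modulus and argument of `y` are the amplitude and the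
  -- phase.
  set y : ℂ := ⟨z.im + h / w, z.re * m⟩ with hy
  refine ⟨‖y‖, arg y, norm_nonneg _, ?_⟩
  have h1 : ‖y‖ * Real.sin (arg y) = z.re * m := Complex.norm_mul_sin_arg y
  have h2 : ‖y‖ * Real.cos (arg y) = z.im + h / w := Complex.norm_mul_cos_arg y
  have h3 : radius h (z.re * m) = w := by
    refine eq_radius hh hw ?_
    rw [mul_pow]
    linear_combination (-z.re ^ 2) * hmw + (w ^ 2 + 1) * hw2
  have h4 : angleSpeed h (z.re * m) = m := by rw [angleSpeed, h3, hm2]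
  apply Complex.ext
  · simp only [orbit, h1, tau, h4]
    field_simp
  · simp only [orbit, h1, h2, h3]
    ring

/-- Every generating curve is a rotation of a model curve. -/
theorem exists_eq_rotation {h : ℝ} (hh : 0 < h) {Y : ℝ → ℂ} (hY : ContDiff ℝ ∞ Y)
    (hn : ∀ s, ‖deriv Y s‖ = 1)
    (hH : ∀ s t, meanCurvature (helicoidalSurface h Y) s t = 1) :
    ∃ R, 0 ≤ R ∧ ∀ X φ θ P, IsModel h R X φ θ P →
      ∃ (ζ : ℂ) (c : ℝ), ‖ζ‖ = 1 ∧ ∀ s, Y s = ζ * X (s + c) := by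
  obtain ⟨z, hz, hT, hzd⟩ := exists_frame hh hY hn hH
  obtain ⟨R, φ₀, hR, hφ₀⟩ := exists_orbit_eq hh (z 0)
  refine ⟨R, hR, fun X φ θ P hX => ?_⟩
  obtain ⟨c, hc⟩ := hX.surjective_phase φ₀
  have hzeq : z = fun s => orbit h R (φ (s + c)) := by
    refine frame_unique hh hzd (fun s => ?_) ?_
    · exact (hX.hasDerivAt_orbit (s + c)).comp_add_const s c
    · rw [zero_add, hc, hφ₀]
  have hE : ∀ s, HasDerivAt (fun s => exp (-(θ (s + c) * I)))
      (exp (-(θ (s + c) * I)) * -(curv h (z s) * I)) s := by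
    intro s
    have h1 := ((((hX.hasDerivAt_angle (s + c)).comp_add_const s c).ofReal_comp.mul_const
      I).neg).cexp
    refine h1.congr_deriv ?_
    rw [hzeq]
    rfl
  -- Both tangents turn with the same curvature, so their quotient is constant; it is the required
  -- rotation.
  have hconst : ∀ s, deriv Y s * exp (-(θ (s + c) * I)) = deriv Y 0 * exp (-(θ (0 + c) * I)) := by
    have hd : ∀ s, HasDerivAt (fun s => deriv Y s * exp (-(θ (s + c) * I))) 0 s := by
      intro s
      refine ((hT s).mul (hE s)).congr_deriv ?_
      ring
    intro s
    exact is_const_of_deriv_eq_zero (fun s => (hd s).differentiableAt) (fun s => (hd s).deriv) s 0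
  refine ⟨deriv Y 0 * exp (-(θ (0 + c) * I)), c, ?_, fun s => ?_⟩
  · rw [norm_mul, hn, one_mul, ← neg_mul, ← ofReal_neg, norm_exp_ofReal_mul_I]
  · rw [← hconst s, hX.eq_mul, hz s, hzeq]
    have : exp (-(θ (s + c) * I)) * exp (θ (s + c) * I) = 1 := by
      rw [← Complex.exp_add, neg_add_cancel, Complex.exp_zero]
    linear_combination (-deriv Y s * orbit h R (φ (s + c))) * this

/-! ### Symmetries and closing of model curves -/

theorem add_int_mul {f : ℝ → ℝ} {P A : ℝ} (hP : P ≠ 0) (hf : ∀ s, f (s + P) = f s + A) (n : ℤ)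
    (s : ℝ) : f (s + n * P) = f s + n * A := by
  -- Subtracting the linear function of slope A/P makes `f` periodic.
  have hper : Function.Periodic (fun s => f s - A / P * s) P := by
    intro s
    simp only [hf]
    field_simp
    ring
  have := hper.int_mul n s
  field_simp at this
  have h2 : P * (f (s + n * P) - (f s + n * A)) = 0 := by linear_combination this
  linarith [(mul_eq_zero.1 h2).resolve_left hP]

/-- τ determines w and hence R sin φ, after which ν determines R cos φ; R > 0 then fixes φ modulo
2π. -/
theorem exists_int_of_orbit_eq {h : ℝ} (hh : 0 < h) {R a b : ℝ} (hR : 0 < R)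
    (hab : orbit h R a = orbit h R b) : ∃ n : ℤ, a = b + n * (2 * Real.pi) := by
  have h1 : tau h (R * Real.sin a) = tau h (R * Real.sin b) := congrArg Complex.re hab
  have h2 : R * Real.cos a - h / radius h (R * Real.sin a) =
    R * Real.cos b - h / radius h (R * Real.sin b) := congrArg Complex.im hab
  have h3 : radius h (R * Real.sin a) = radius h (R * Real.sin b) := by
    rw [← pow_left_inj₀ (radius_pos hh _).le (radius_pos hh _).le two_ne_zero, ← tau_sq hh,
      ← tau_sq hh, h1]
  have h4 : angleSpeed h (R * Real.sin a) = angleSpeed h (R * Real.sin b) := by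
    rw [angleSpeed, angleSpeed, h3]
  have hs : Real.sin a = Real.sin b := by
    apply mul_left_cancel₀ hR.ne'
    rw [← tau_mul_angleSpeed h (R * Real.sin a), ← tau_mul_angleSpeed h (R * Real.sin b), h1, h4]
  have hc : Real.cos a = Real.cos b := by
    rw [h3] at h2
    exact mul_left_cancel₀ hR.ne' (by linarith)
  obtain ⟨n, hn⟩ := Real.Angle.angle_eq_iff_two_pi_dvd_sub.1 (Real.Angle.cos_sin_inj hc hs)
  exact ⟨n, by linarith⟩

theorem exp_int_mul_mul_I (n : ℤ) (A : ℝ) :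
    exp (((n * A : ℝ) : ℂ) * I) = exp ((A : ℂ) * I) ^ n := by
  rw [← Complex.exp_int_mul]
  push_cast
  ring_nf

namespace IsModel

variable {h R P : ℝ} {X : ℝ → ℂ} {φ θ : ℝ → ℝ}

theorem deriv_eq (hX : IsModel h R X φ θ P) (s : ℝ) : deriv X s = exp (θ s * I) :=
  (hX.hasDerivAt s).deriv

theorem norm_deriv (hX : IsModel h R X φ θ P) (s : ℝ) : ‖deriv X s‖ = 1 := by
  rw [hX.deriv_eq, norm_exp_ofReal_mul_I]

theorem continuous_angle (hX : IsModel h R X φ θ P) : Continuous θ :=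
  continuous_iff_continuousAt.2 fun s => (hX.hasDerivAt_angle s).continuousAt

theorem add_int_mul_period (hX : IsModel h R X φ θ P) (n : ℤ) (s : ℝ) :
    X (s + n * P) = exp ((totalAngle h R : ℝ) * I) ^ n * X s := by
  rw [hX.eq_mul, hX.eq_mul s, add_int_mul hX.pos.ne' hX.phase_add,
    add_int_mul hX.pos.ne' hX.angle_add, ← exp_int_mul_mul_I, ofReal_add, add_mul, Complex.exp_add]
  have : orbit h R (φ s + n * (2 * Real.pi)) = orbit h R (φ s) :=
    Function.Periodic.int_mul (orbit_add_two_pi h R) n _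
  rw [this]
  ring

/-- The rotational symmetries of a model curve. -/
theorem symmetry_iff (hh : 0 < h) (hR : 0 < R) (hX : IsModel h R X φ θ P) (ζ : ℂ) (c : ℝ) :
    (∀ s, ζ * X s = X (s + c)) ↔
      ∃ m : ℤ, c = m * P ∧ ζ = exp ((totalAngle h R : ℝ) * I) ^ m := by
  constructor
  · intro H
    have hT : ∀ s, ζ * exp (θ s * I) = exp (θ (s + c) * I) := fun s => by
      have h1 := (hX.hasDerivAt s).const_mul ζ
      have h2 := (hX.hasDerivAt (s + c)).comp_add_const s c
      rw [← funext H] at h2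
      exact h1.unique h2
    -- A rotation turns X and X' alike, so a symmetry preserves z; the shift must then be a whole
    -- number of periods of the orbit.
    have hz : orbit h R (φ (0 + c)) = orbit h R (φ 0) := by
      have h1 := H 0
      rw [hX.eq_mul, hX.eq_mul (0 + c), ← hT] at h1
      have h2 : ζ * exp (θ 0 * I) ≠ 0 := by
        rw [hT]; exact Complex.exp_ne_zero _
      exact mul_right_cancel₀ h2 (by rw [← h1]; ring)
    obtain ⟨m, hm⟩ := exists_int_of_orbit_eq hh hR hz
    have hc : c = m * P := by
      rw [← add_int_mul hX.pos.ne' hX.phase_add] at hm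
      simpa using hX.strictMono_phase.injective hm
    refine ⟨m, hc, ?_⟩
    have h1 := hT 0
    rw [hc, add_int_mul hX.pos.ne' hX.angle_add, ofReal_add, add_mul, Complex.exp_add,
      exp_int_mul_mul_I, mul_comm] at h1
    exact mul_left_cancel₀ (Complex.exp_ne_zero _) h1
  · rintro ⟨m, rfl, rfl⟩ s
    exact (hX.add_int_mul_period m s).symm

theorem periodic_iff (hh : 0 < h) (hR : 0 < R) (hX : IsModel h R X φ θ P) (c : ℝ) :
    Function.Periodic X c ↔ ∃ m : ℤ, c = m * P ∧ exp ((totalAngle h R : ℝ) * I) ^ m = 1 := by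
  have := hX.symmetry_iff hh hR 1 c
  simp only [one_mul, eq_comm (a := (1 : ℂ))] at this
  rw [← this]
  exact forall_congr' fun s => eq_comm

end IsModel

theorem isPrimitiveRoot_exp_div {p q : ℕ} (hq : 0 < q) (hpq : p.Coprime q) :
    IsPrimitiveRoot (exp (((2 * Real.pi * (p / q) : ℝ) : ℂ) * I)) q := by
  have := (Complex.isPrimitiveRoot_exp q hq.ne').pow_of_coprime p hpq
  rw [← Complex.exp_nat_mul] at this
  convert this using 2
  push_cast
  ring

namespace IsModel

variable {h R P : ℝ} {X : ℝ → ℂ} {φ θ : ℝ → ℝ}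

/-- A model curve closes up when its total angle is the right rational multiple of `2π`. -/
theorem isGeneratingCurve (hh : 0 < h) (hR : 0 < R) (hX : IsModel h R X φ θ P) {p q : ℕ}
    (hq : 0 < q) (hpq : p.Coprime q) (hA : totalAngle h R = 2 * Real.pi * (p / q)) :
    IsGeneratingCurve h p q X (q * P) := by
  have hroot : IsPrimitiveRoot (exp ((totalAngle h R : ℝ) * I)) q := by
    rw [hA]; exact isPrimitiveRoot_exp_div hq hpq
  have hq' : (0 : ℝ) < q := Nat.cast_pos.2 hq
  have hP := hX.pos
  refine ⟨⟨hX.smooth, hX.norm_deriv, by positivity, ?_, ?_⟩, ⟨fun s => ?_, θ, hX.continuous_angle,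
    fun s => ?_, ?_⟩, fun ζ => ?_, fun s t => ?_⟩
  · rw [hX.periodic_iff hh hR]
    exact ⟨q, by simp, by simpa using hroot.pow_eq_one⟩
  · intro c hc hper
    obtain ⟨m, rfl, hm⟩ := (hX.periodic_iff hh hR c).1 hper
    have h1 := (hroot.zpow_eq_one_iff_dvd m).1 hm
    have h2 : 0 < m := by
      have := pos_of_mul_pos_left hc hP.le
      exact_mod_cast this
    have h3 := Int.le_of_dvd h2 h1
    have h4 : (q : ℝ) ≤ m := by exact_mod_cast h3
    gcongr
  · rw [hX.deriv_eq]; exact Complex.exp_ne_zero _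
  · rw [hX.norm_deriv, hX.deriv_eq, ofReal_one, one_mul]
  · have := add_int_mul hP.ne' hX.angle_add q 0
    rw [zero_add] at this
    push_cast at this
    rw [this, hA]
    push_cast
    field_simp
    ring
  · constructor
    · rintro ⟨_, c, hc⟩
      obtain ⟨m, -, rfl⟩ := (hX.symmetry_iff hh hR ζ c).1 hc
      rw [← zpow_natCast, ← zpow_mul, mul_comm m, zpow_mul, zpow_natCast, hroot.pow_eq_one,
        one_zpow]
    · intro hζ
      refine ⟨Complex.norm_eq_one_of_pow_eq_one hζ hq.ne', ?_⟩
      have : NeZero q := ⟨hq.ne'⟩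
      obtain ⟨i, -, hi⟩ := hroot.eq_pow_of_pow_eq_one hζ
      exact ⟨i * P, (hX.symmetry_iff hh hR ζ _).2 ⟨i, by simp, by simp [hi]⟩⟩
  · have hT : ∀ s, HasDerivAt (fun s => exp (θ s * I))
        (curv h (orbit h R (φ s)) * I * exp (θ s * I)) s := fun s =>
      (((hX.hasDerivAt_angle s).ofReal_comp.mul_const I).cexp).congr_deriv (mul_comm _ _)
    rw [meanCurvature_helicoidalSurface hh hX.hasDerivAt hT s t (norm_exp_ofReal_mul_I _)
      (hX.eq_mul s) rfl, meanCurvature_eq_one_iff hh]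

end IsModel

/-! ### Amplitude and length are determined by p and q -/

theorem le_of_exp_mul_I_eq {f : ℝ → ℝ} (hf : Continuous f) {w : ℂ}
    (hw : ∀ s, exp (f s * I) = w) (s t : ℝ) : f s ≤ f t := by
  by_contra! hlt
  obtain ⟨n, hn⟩ := (Complex.exp_eq_exp_iff_exists_int).1 ((hw s).trans (hw t).symm)
  have h1 : f s = f t + n * (2 * Real.pi) := by
    have h2 : ((f s : ℝ) : ℂ) * I = ((f t + n * (2 * Real.pi) : ℝ) : ℂ) * I := by
      rw [hn]; push_cast; ring
    exact_mod_cast mul_right_cancel₀ I_ne_zero h2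
  have hn0 : (0 : ℝ) < n := by
    have : 0 < n * (2 * Real.pi) := by linarith
    exact pos_of_mul_pos_left this Real.two_pi_pos.le
  have hn1 : (1 : ℝ) ≤ n := by
    have : 0 < n := by exact_mod_cast hn0
    exact_mod_cast this
  have hpi := Real.pi_pos
  -- If f s exceeded f t, it would do so by at least 2π, so `f` would take the value f t + π, where
  -- the exponential has the opposite sign.
  obtain ⟨r, hr⟩ := mem_range_of_exists_le_of_exists_ge hf (c := f t + Real.pi)
    ⟨t, by linarith⟩ ⟨s, by nlinarith⟩
  have h3 := hw r
  rw [hr, ← hw t, ofReal_add, add_mul, Complex.exp_add, Complex.exp_pi_mul_I, mul_neg_one] at h3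
  exact Complex.exp_ne_zero (f t * I) (self_eq_neg.1 h3.symm)

/-- A continuous angle function of a unit curve is unique up to a constant. -/
theorem sub_eq_sub_of_exp_mul_I_eq {f g : ℝ → ℝ} (hf : Continuous f) (hg : Continuous g) {w : ℂ}
    (hw : ∀ s, exp (f s * I) = w * exp (g s * I)) (s t : ℝ) : f s - f t = g s - g t := by
  have h1 : ∀ s, exp (((f s - g s : ℝ) : ℂ) * I) = w := fun s => by
    rw [ofReal_sub, sub_mul, Complex.exp_sub, hw, mul_div_cancel_right₀ _ (Complex.exp_ne_zero _)]
  have h2 : f s - g s ≤ f t - g t := le_of_exp_mul_I_eq (hf.sub hg) h1 s t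
  have h3 : f t - g t ≤ f s - g s := le_of_exp_mul_I_eq (hf.sub hg) h1 t s
  linarith

/-- The circle traced for amplitude zero has too many symmetries. -/
theorem IsModel.pos_of_hasFoldSymmetry {h R P : ℝ} {X : ℝ → ℂ} {φ θ : ℝ → ℝ} (hh : 0 < h)
    (hR : 0 ≤ R) (hX : IsModel h R X φ θ P) {q : ℕ} (hq : 0 < q) (hs : HasFoldSymmetry X q) :
    0 < R := by
  refine lt_of_le_of_ne hR ?_
  rintro rfl
  have horb : ∀ x, orbit h 0 x = -I := fun x => by
    apply Complex.ext <;> simp [orbit, tau_zero, radius_zero hh, hh.ne']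
  have hcurv : curv h (-I) = 1 := by
    have : √(h ^ 2) = h := Real.sqrt_sq hh.le
    simp only [curv, neg_re, I_re, neg_im, I_im, neg_zero, ne_eq, OfNat.ofNat_ne_zero,
      not_false_eq_true, zero_pow, zero_add, this]
    field_simp
    ring
  have hθ : ∀ s, θ s = θ 0 + s := by
    have hd : ∀ s, HasDerivAt (fun s => θ s - s) 0 s := fun s => by
      have := (hX.hasDerivAt_angle s).sub (hasDerivAt_id s)
      rw [horb, hcurv, sub_self] at this
      exact this
    intro s
    have := is_const_of_deriv_eq_zero (fun s => (hd s).differentiableAt) (fun s => (hd s).deriv) s 0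
    linarith
  have hq' : (q : ℝ) ≠ 0 := by positivity
  -- The unit circle is carried to itself by e^{iπ/q}, whose q-th power is −1.
  have h1 := (hs (exp (((Real.pi / q : ℝ) : ℂ) * I))).1
    ⟨norm_exp_ofReal_mul_I _, Real.pi / q, fun s => by
      rw [hX.eq_mul, hX.eq_mul (s + _), horb, horb, hθ s, hθ (s + _), ← add_assoc,
        ofReal_add _ (Real.pi / q), add_mul, Complex.exp_add]
      ring⟩
  rw [← Complex.exp_nat_mul] at h1
  have h2 : (q : ℂ) * (((Real.pi / q : ℝ) : ℂ) * I) = Real.pi * I := by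
    have : (q : ℂ) ≠ 0 := by exact_mod_cast hq.ne'
    push_cast
    field_simp
  rw [h2, Complex.exp_pi_mul_I] at h1
  norm_num at h1

/-- The amplitude and the length of a closed generating curve are determined by `p` and `q`. -/
theorem IsModel.of_rotation {h R P : ℝ} {X : ℝ → ℂ} {φ θ : ℝ → ℝ} (hh : 0 < h)
    (hR : 0 ≤ R) (hX : IsModel h R X φ θ P) {p q : ℕ} (hq : 0 < q) {Y : ℝ → ℂ} {M : ℝ}
    (hY : IsGeneratingCurve h p q Y M) {ζ : ℂ} {c : ℝ} (hζ : ‖ζ‖ = 1)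
    (hXY : ∀ s, Y s = ζ * X (s + c)) :
    0 < R ∧ totalAngle h R = 2 * Real.pi * (p / q) ∧ M = q * P := by
  have hζ0 : ζ ≠ 0 := by
    rintro rfl; simp at hζ
  have hsymm : ∀ (η : ℂ) (d : ℝ), (∀ s, η * Y s = Y (s + d)) ↔ ∀ s, η * X s = X (s + d) := by
    intro η d
    constructor <;> intro H s
    · have := H (s - c)
      rw [hXY, hXY, sub_add_cancel, show s - c + d + c = s + d by ring] at this
      exact mul_left_cancel₀ hζ0 (by rw [← this]; ring)
    · rw [hXY, hXY, show s + d + c = s + c + d by ring, ← H]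
      ring
  have hfold : HasFoldSymmetry X q := by
    intro η
    rw [← hY.symmetric η]
    simp only [hsymm]
  have hR0 := hX.pos_of_hasFoldSymmetry hh hR hq hfold
  have hper : ∀ d, Function.Periodic Y d ↔ Function.Periodic X d := by
    intro d
    have := hsymm 1 d
    simp only [one_mul] at this
    exact (forall_congr' fun s => eq_comm).trans (this.trans (forall_congr' fun s => eq_comm))
  obtain ⟨n, hn, hn1⟩ := (hX.periodic_iff hh hR0 M).1 ((hper M).1 hY.closed.periodic)
  have hP := hX.pos
  have hq' : (0 : ℝ) < q := Nat.cast_pos.2 hq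
  have hnpos : 0 < n := by
    have h1 := hY.closed.pos
    rw [hn] at h1
    exact_mod_cast pos_of_mul_pos_left h1 hP.le
  set ξ : ℂ := exp ((totalAngle h R : ℝ) * I) with hξ
  have hξq : ξ ^ q = 1 := (hfold ξ).1 ⟨norm_exp_ofReal_mul_I _, P,
    (hX.symmetry_iff hh hR0 ξ P).2 ⟨1, by simp, by simp [hξ]⟩⟩
  -- Rotation by ξ is a symmetry, so ξ^q = 1 and qP is a period; minimality of M = nP gives n ≤ q.
  have hle : n ≤ q := by
    have h1 := hY.closed.least (q * P) (by positivity)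
      ((hper _).2 ((hX.periodic_iff hh hR0 _).2 ⟨q, by simp, by simpa using hξq⟩))
    rw [hn] at h1
    have h2 := le_of_mul_le_mul_right h1 hP
    exact_mod_cast h2
  -- The primitive root e^{2πi/q} is also a symmetry, hence a power of ξ, so its n-th power is 1.
  have hdvd : (q : ℤ) ∣ n := by
    have hprim := Complex.isPrimitiveRoot_exp q hq.ne'
    obtain ⟨-, d, hd⟩ := (hfold _).2 hprim.pow_eq_one
    obtain ⟨m, -, hm⟩ := (hX.symmetry_iff hh hR0 _ d).1 hd
    rw [← hprim.zpow_eq_one_iff_dvd, hm, ← zpow_mul, mul_comm m, zpow_mul, hn1, one_zpow]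
  have hnq : n = q := le_antisymm hle (Int.le_of_dvd hnpos hdvd)
  refine ⟨hR0, ?_, by rw [hn, hnq]; simp⟩
  obtain ⟨-, ψ, hψ, hψeq, hψM⟩ := hY.rotation
  have hdY : ∀ s, deriv Y s = ζ * exp (θ (s + c) * I) := fun s => by
    rw [funext hXY]
    exact (((hX.hasDerivAt (s + c)).comp_add_const s c).const_mul ζ).deriv
  -- The angle witnessing the rotation number differs from the shifted θ by a constant, so 2πp
  -- equals q times the total angle.
  have hang := sub_eq_sub_of_exp_mul_I_eq hψ
    (hX.continuous_angle.comp (continuous_add_const c)) (w := ζ) (fun s => by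
      have := hψeq s
      rw [hY.closed.unit_speed, ofReal_one, one_mul, hdY] at this
      exact this.symm) M 0
  have h3 := add_int_mul hP.ne' hX.angle_add n c
  simp only [Function.comp_apply] at hang
  rw [hψM, zero_add, hn, add_comm (n * P) c, h3, hnq] at hang
  push_cast at hang
  field_simp
  linarith

/-! ### Passage through the origin and winding numbers -/

theorem orbit_eq_zero_iff {h : ℝ} (hh : 0 < h) {R : ℝ} (hR : 0 < R) (φ : ℝ) :
    orbit h R φ = 0 ↔ R = 1 ∧ Real.cos φ = 1 := by
  constructor
  · intro H
    have h1 : tau h (R * Real.sin φ) = 0 := congrArg Complex.re H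
    have h2 : R * Real.cos φ - h / radius h (R * Real.sin φ) = 0 := congrArg Complex.im H
    have h3 : R * Real.sin φ = 0 := by
      rw [← tau_mul_angleSpeed h (R * Real.sin φ), h1, zero_mul]
    rw [h3, radius_zero hh, div_self hh.ne'] at h2
    have h4 := (mul_eq_zero.1 h3).resolve_left hR.ne'
    have h5 := Real.sin_sq_add_cos_sq φ
    have h6 : R ^ 2 = 1 := by
      rw [h4] at h5
      have : R * Real.cos φ = 1 := by linarith
      calc R ^ 2 = (R * Real.cos φ) ^ 2 := by rw [mul_pow]; nlinarith
        _ = 1 := by rw [this]; norm_num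
    have h7 : R = 1 := by nlinarith
    exact ⟨h7, by rw [h7] at h2; linarith⟩
  · rintro ⟨rfl, hc⟩
    have hs : Real.sin φ = 0 := by
      have := Real.sin_sq_add_cos_sq φ
      rw [hc] at this
      nlinarith
    apply Complex.ext <;> simp [orbit, hs, hc, tau_zero, radius_zero hh, hh.ne']

/-- For amplitude less than one the orbit does not wind around the origin. -/
theorem I_mul_orbit_mem_slitPlane {h : ℝ} (hh : 0 < h) {R : ℝ} (hR : 0 < R) (hR1 : R < 1) (φ : ℝ) :
    I * orbit h R φ ∈ slitPlane := by
  rw [mem_slitPlane_iff]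
  -- τ vanishes only with sin φ, and there iz = 1 − R cos φ is positive because R < 1.
  by_cases hs : Real.sin φ = 0
  · left
    have : R * Real.cos φ < 1 := by nlinarith [Real.cos_le_one φ]
    simpa [orbit, hs, radius_zero hh, hh.ne'] using this
  · right
    simpa [orbit, tau] using ⟨⟨hR.ne', hs⟩, (angleSpeed_pos h _).ne'⟩

/-- For amplitude greater than one the orbit winds around the origin like the phase. -/
theorem orbit_mul_exp_mem_slitPlane {h : ℝ} (hh : 0 < h) {R : ℝ} (hR1 : 1 < R) (φ : ℝ) :
    -I * orbit h R φ * exp (φ * I) ∈ slitPlane := by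
  have hR : 0 < R := by linarith
  have hre : (-I * orbit h R φ * exp (φ * I)).re =
      (orbit h R φ).im * Real.cos φ + (orbit h R φ).re * Real.sin φ := by
    simp [exp_ofReal_mul_I_re, exp_ofReal_mul_I_im]
    ring
  have him : (-I * orbit h R φ * exp (φ * I)).im =
      (orbit h R φ).im * Real.sin φ - (orbit h R φ).re * Real.cos φ := by
    simp [exp_ofReal_mul_I_re, exp_ofReal_mul_I_im]
    ring
  have hsc := Real.sin_sq_add_cos_sq φ
  rw [mem_slitPlane_iff, hre, him]
  -- Otherwise z = r(sin φ + i cos φ) with r ≤ 0. If sin φ ≠ 0, comparing τ gives r times the angle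
  -- speed equal to R > 0; if sin φ = 0, comparing ν gives r = R ∓ 1 > 0.
  by_contra! hcon
  obtain ⟨h1, h2⟩ := hcon
  set r := (orbit h R φ).im * Real.cos φ + (orbit h R φ).re * Real.sin φ with hr
  have h3 : (orbit h R φ).re = r * Real.sin φ := by
    rw [hr]
    linear_combination (-(orbit h R φ).re) * hsc - Real.cos φ * h2
  have h4 : (orbit h R φ).im = r * Real.cos φ := by
    rw [hr]
    linear_combination (-(orbit h R φ).im) * hsc + Real.sin φ * h2
  by_cases hs : Real.sin φ = 0
  · rw [hs] at hsc
    have h5 : (orbit h R φ).im = R * Real.cos φ - 1 := by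
      simp [orbit, hs, radius_zero hh, hh.ne']
    have h6 := Real.cos_le_one φ
    nlinarith
  · have h5 : (orbit h R φ).re * angleSpeed h (R * Real.sin φ) = R * Real.sin φ :=
      tau_mul_angleSpeed h _
    have h6 := angleSpeed_pos h (R * Real.sin φ)
    rw [h3] at h5
    have h7 : r * angleSpeed h (R * Real.sin φ) = R :=
      mul_right_cancel₀ hs (by linear_combination h5)
    nlinarith

/-- A polar angle obtained by comparison with a curve whose polar angle is known. -/
theorem hasWindingNumber_of_mul_exp {γ : ℝ → ℂ} {L : ℝ} {n : ℤ} {g : ℝ → ℝ} (hγ : Continuous γ)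
    (hper : γ L = γ 0) (hg : Continuous g) (hgL : g L - g 0 = 2 * Real.pi * n) {ζ : ℂ}
    (hζ : ‖ζ‖ = 1) (hs : ∀ s, ζ * γ s * exp (-(g s * I)) ∈ slitPlane) :
    HasWindingNumber γ L n := by
  have hcont : Continuous fun s => ζ * γ s * exp (-(g s * I)) := by fun_prop
  have hζ0 : ζ ≠ 0 := by rintro rfl; simp at hζ
  have hexp : exp (-(g L * I)) = exp (-(g 0 * I)) := by
    rw [show g L = g 0 + 2 * Real.pi * n by linarith]
    rw [Complex.exp_eq_exp_iff_exists_int]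
    exact ⟨-n, by push_cast; ring⟩
  have hζarg : ζ = exp (arg ζ * I) := by
    have := Complex.norm_mul_exp_arg_mul_I ζ
    rw [hζ, ofReal_one, one_mul] at this
    exact this.symm
  -- The principal argument is continuous off the cut and takes equal values at 0 and L, so the
  -- increase of the polar angle is that of `g`.
  refine ⟨fun s h0 => slitPlane_ne_zero (hs s) (by rw [h0]; simp),
    fun s => arg (ζ * γ s * exp (-(g s * I))) + g s - arg ζ, ?_, fun s => ?_, ?_⟩
  · refine (Continuous.add ?_ hg).sub continuous_const
    exact continuous_iff_continuousAt.2 fun s =>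
      ContinuousAt.comp (g := arg) (f := fun s => ζ * γ s * exp (-(g s * I)))
        (continuousAt_arg (hs s)) hcont.continuousAt
  · have h1 := Complex.norm_mul_exp_arg_mul_I (ζ * γ s * exp (-(g s * I)))
    have h2 : ‖ζ * γ s * exp (-(g s * I))‖ = ‖γ s‖ := by
      rw [norm_mul, norm_mul, hζ, ← neg_mul, ← ofReal_neg, norm_exp_ofReal_mul_I]
      ring
    rw [h2] at h1
    push_cast
    rw [sub_mul, add_mul, Complex.exp_sub, Complex.exp_add, ← hζarg, mul_div_assoc',
      ← mul_assoc, h1, eq_div_iff hζ0, mul_assoc (ζ * γ s), ← Complex.exp_add, neg_add_cancel,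
      Complex.exp_zero]
    ring
  · simp only [hper, hexp]
    linarith

namespace IsModel

variable {h R P : ℝ} {X : ℝ → ℂ} {φ θ : ℝ → ℝ} {p q : ℕ}

theorem exists_eq_zero_iff (hh : 0 < h) (hR : 0 < R) (hX : IsModel h R X φ θ P) :
    (∃ s, X s = 0) ↔ R = 1 := by
  simp only [hX.eq_mul, mul_eq_zero, Complex.exp_ne_zero, or_false, orbit_eq_zero_iff hh hR]
  constructor
  · rintro ⟨s, hs, -⟩
    exact hs
  · intro H
    obtain ⟨s, hs⟩ := hX.surjective_phase 0
    exact ⟨s, H, by rw [hs, Real.cos_zero]⟩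

theorem hasWindingNumber_of_lt_one (hh : 0 < h) (hR : 0 < R) (hX : IsModel h R X φ θ P)
    (hG : IsGeneratingCurve h p q X (q * P)) (hq : 0 < q)
    (hA : totalAngle h R = 2 * Real.pi * (p / q)) (hR1 : R < 1) :
    HasWindingNumber X (q * P) p := by
  have hq' : (q : ℝ) ≠ 0 := by positivity
  refine hasWindingNumber_of_mul_exp (g := θ) (ζ := I) hG.closed.smooth.continuous ?_
    hX.continuous_angle ?_ (by simp) fun s => ?_
  · simpa using hG.closed.periodic 0
  · have := add_int_mul hX.pos.ne' hX.angle_add q 0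
    rw [zero_add] at this
    push_cast at this ⊢
    rw [this, hA]
    field_simp
    ring
  · rw [hX.eq_mul, mul_assoc, mul_assoc, ← Complex.exp_add, add_neg_cancel, Complex.exp_zero,
      mul_one]
    exact I_mul_orbit_mem_slitPlane hh hR hR1 _

theorem hasWindingNumber_of_one_lt (hh : 0 < h) (hX : IsModel h R X φ θ P)
    (hG : IsGeneratingCurve h p q X (q * P)) (hq : 0 < q)
    (hA : totalAngle h R = 2 * Real.pi * (p / q)) (hR1 : 1 < R) :
    HasWindingNumber X (q * P) ((p : ℤ) - q) := by
  have hq' : (q : ℝ) ≠ 0 := by positivity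
  refine hasWindingNumber_of_mul_exp (g := fun s => θ s - φ s) (ζ := -I)
    hG.closed.smooth.continuous ?_ (hX.continuous_angle.sub hX.continuous_phase) ?_ (by simp)
    fun s => ?_
  · simpa using hG.closed.periodic 0
  · have h1 := add_int_mul hX.pos.ne' hX.angle_add q 0
    have h2 := add_int_mul hX.pos.ne' hX.phase_add q 0
    rw [zero_add] at h1 h2
    push_cast at h1 h2 ⊢
    rw [h1, h2, hA]
    field_simp
    ring
  · have h1 : -I * X s * exp (-(((θ s - φ s : ℝ) : ℂ) * I)) =
        -I * orbit h R (φ s) * exp (φ s * I) := by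
      rw [hX.eq_mul, mul_assoc, mul_assoc, ← Complex.exp_add, mul_assoc]
      congr 3
      push_cast
      ring_nf
    rw [h1]
    exact orbit_mul_exp_mem_slitPlane hh hR1 _

end IsModel

end CMCHelicoid

/-! ### Existence, uniqueness and the trichotomy at the critical ratio -/

theorem mainTheorem1 (h : ℝ) (hh : 0 < h) (p q : ℕ) (hp : 0 < p) (hq : 0 < q)
    (hpq : Nat.Coprime p q) (hlow : 1 < (p : ℝ) / q)
    (hupp : (p : ℝ) / q < Real.sqrt (h ^ 2 + 1) / h) :
    ∃ (X : ℝ → ℂ) (L : ℝ), CMCHelicoid.IsGeneratingCurve h p q X L ∧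
      (∀ (Y : ℝ → ℂ) (M : ℝ), CMCHelicoid.IsGeneratingCurve h p q Y M →
        M = L ∧ CMCHelicoid.EqUpToRotation X Y) ∧
      ((∃ s, X s = 0) ↔ (p : ℝ) / q = CMCHelicoid.criticalRatio h) ∧
      (CMCHelicoid.criticalRatio h < (p : ℝ) / q →
        CMCHelicoid.HasWindingNumber X L p) ∧
      ((p : ℝ) / q < CMCHelicoid.criticalRatio h →
        CMCHelicoid.HasWindingNumber X L ((p : ℤ) - q)) := by
  open CMCHelicoid in
  obtain ⟨R, hR, hA⟩ := exists_totalAngle_eq hh hlow hupp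
  obtain ⟨X, φ, θ, P, hX⟩ := exists_isModel hh R
  have hG := hX.isGeneratingCurve hh hR hq hpq hA
  have hpi := Real.two_pi_pos
  refine ⟨X, q * P, hG, fun Y M hY => ?_, ?_, fun hlt => ?_, fun hlt => ?_⟩
  · obtain ⟨S, hS, hSX⟩ := exists_eq_rotation hh hY.closed.smooth hY.closed.unit_speed
      hY.meanCurvature_eq
    -- An auxiliary model of amplitude `S` serves only to compute its total angle; injectivity then
    -- gives S = R, and Y can be compared with X itself.
    obtain ⟨X', φ', θ', P', hX'⟩ := exists_isModel hh S
    obtain ⟨ζ', c', hζ', hc'⟩ := hSX X' φ' θ' P' hX'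
    obtain ⟨-, hS2, -⟩ := hX'.of_rotation hh hS hq hY hζ' hc'
    obtain rfl := (totalAngle_inj hh hR.le hS).1 (hA.trans hS2.symm)
    obtain ⟨ζ, c, hζ, hc⟩ := hSX X φ θ P hX
    exact ⟨(hX.of_rotation hh hS hq hY hζ hc).2.2, ζ, hζ, c, hc⟩
  · rw [hX.exists_eq_zero_iff hh hR, ← totalAngle_inj hh hR.le zero_le_one, hA, totalAngle_one hh,
      mul_right_inj' hpi.ne']
  · refine hX.hasWindingNumber_of_lt_one hh hR hG hq hA ?_
    rw [← totalAngle_lt_iff hh hR.le zero_le_one, hA, totalAngle_one hh]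
    gcongr
  · refine hX.hasWindingNumber_of_one_lt hh hG hq hA ?_
    rw [← totalAngle_lt_iff hh zero_le_one hR.le, hA, totalAngle_one hh]
    gcongr
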